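/- Let $\Gamma$ be a finite bipartite distance-regular graph with vertex set $X$, path-length distance $\partial$, diameter $D\ge 4$, valency $k\ge 3$ and intersection numbers $p^h_{ij}=|\{z:\partial(x,z)=i,\ \partial(z,y)=j\}|$ (for any $x,y$ with $\partial(x,y)=h$). Put $c_i=p^i_{1,i-1}$ $(1\le i\le D)$, $b_i=p^i_{1,i+1}$ $(0\le i\le D-1)$, $k_i=p^0_{ii}$ $(0\le i\le D)$, and $c_0=b_D=0$. Let $A_i\in \mathrm{Mat}_X(\mathbb C)$ $(0\le i\le D)$ be the $i$th distance matrix, with $(y,z)$-entry $1$ if $\partial(y,z)=i$ and $0$ otherwise, let $A=A_1$, and let $\theta_0>\theta_1>\cdots>\theta_D$ be the distinct eigenvalues of $A$. Let $f_0,f_1,\dots,f_D\in\mathbb R[\lambda]$ be the polynomials with $f_0=1$, $f_{-1}=0$ and $\lambda f_i=b_{i-1}f_{i-1}+c_{i+1}f_{i+1}$ $(0\le i\le D-1)$, and let $p_i=f_i+f_{i-2}+f_{i-4}+\cdots$ (ending in $f_0$ or $f_1$) for $0\le i\le D$. Fix $x\in X$. For $0\le i\le D$ let $E_i^*$ be the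 diagonal matrix in $\mathrm{Mat}_X(\mathbb C)$ with $(y,y)$-entry $1$ if $\partial(x,y)=i$ and $0$ otherwise, and let $T$ be the subalgebra of $\mathrm{Mat}_X(\mathbb C)$ generated by $A,E_0^*,\dots,E_D^*$. A $T$-module is a $T$-invariant subspace $W$ of $\mathbb C^X$ (equipped with the standard Hermitian inner product); it is irreducible if it is nonzero and contains no $T$-modules other than $0$ and $W$. An irreducible $T$-module $W$ is thin if $\dim E_i^*W\le 1$ for $0\le i\le D$, and its endpoint is $\min\{i: E_i^*W\neq 0\}$. If $W$ is thin irreducible with endpoint $2$, its local eigenvalue is the scalar by which $E_2^*A_2E_2^*$ acts on the one-dimensional space $E_2^*W$. Let $d=\lfloor D/2\rfloor$; choose $n\in\{1,d\}$ if $D$ is odd, and let $n=1$ if $D$ is even. Let $W$ be a thin irreducible $T$-module with endpoint $2$ and local eigenvalue $$\tilde\theta_n=-1-\frac{b_2b_3}{\theta_n^2-b_2},$$ and let $v$ be a nonzero vector in $E_2^*W$. Then the vectors $E_{i+2}^*A_iv$ $(0\le i\le D-4)$ form a basis of $W$, they are mutually orthogonal, and $$\|E_{i+2}^*A_iv\|^2=\frac{k_ib_ib_{i+1}c_{i+1}c_{i+2}}{k\,b_1(\theta_n^2-b_2)}\,\frac{p_{i+2}(\theta_n)}{p_i(\theta_n)}\,\|v\|^2\qquad(0\le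 i\le D-4),$$ where all denominators, including $\theta_n^2-b_2$, are nonzero. -/

import Mathlib

open scoped Polynomial

namespace DRG

noncomputable section

variable {X : Type*} [Fintype X] [DecidableEq X]

/-- The number of vertices `z` at distance `i` from `x` and at distance `j` from `y`. -/
def pairCount (G : SimpleGraph X) (i j : ℕ) (x y : X) : ℕ :=
  (Finset.univ.filter fun z : X => G.dist x z = i ∧ G.dist z y = j).card

/-- A finite connected graph is distance-regular if `pairCount G i j x y` depends, apart from
`i` and `j`, only on the distance of `x` and `y`. -/
def IsDistanceRegular (G : SimpleGraph X) : Prop :=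
  G.Connected ∧ ∀ (i j : ℕ) (x y x' y' : X), G.dist x y = G.dist x' y' →
    pairCount G i j x y = pairCount G i j x' y'

open Classical in
/-- The intersection number `p^h_{ij}`: the value of `pairCount G i j` at any pair of vertices at
distance `h` (and `0` if there is no such pair). -/
def interNum (G : SimpleGraph X) (h i j : ℕ) : ℕ :=
  if H : ∃ q : X × X, G.dist q.1 q.2 = h then pairCount G i j H.choose.1 H.choose.2 else 0

/-- `c_i = p^i_{1,i-1}`, with `c_0 = 0`. -/
def c (G : SimpleGraph X) (i : ℕ) : ℕ := if i = 0 then 0 else interNum G i 1 (i - 1)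

/-- `b_i = p^i_{1,i+1}`; it is `0` for `i` equal to the diameter. -/
def b (G : SimpleGraph X) (i : ℕ) : ℕ := interNum G i 1 (i + 1)

/-- The `i`-th valency `k_i = p^0_{ii}`. -/
def kval (G : SimpleGraph X) (i : ℕ) : ℕ := interNum G 0 i i

/-- The polynomials `f_i`: `f_0 = 1` and `λ f_i = b_{i-1} f_{i-1} + c_{i+1} f_{i+1}`,
with `f_{-1} = 0`. -/
def fPoly (G : SimpleGraph X) : ℕ → ℝ[X]
  | 0 => 1
  | 1 => Polynomial.C ((c G 1 : ℝ)⁻¹) * Polynomial.X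
  | i + 2 => Polynomial.C ((c G (i + 2) : ℝ)⁻¹) *
      (Polynomial.X * fPoly G (i + 1) - Polynomial.C (b G i : ℝ) * fPoly G i)

/-- The polynomials `p_i = f_i + f_{i-2} + f_{i-4} + ⋯`, ending in `f_0` or `f_1`. -/
def pPoly (G : SimpleGraph X) (i : ℕ) : ℝ[X] :=
  ∑ h ∈ (Finset.range (i + 1)).filter (fun h => Even (i - h)), fPoly G h

/-- The finite set of distinct eigenvalues of the adjacency matrix. -/
def eigenvalueSet (G : SimpleGraph X) [DecidableRel G.Adj] : Finset ℝ :=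
  (Module.End.finite_hasEigenvalue (Matrix.toLin' (G.adjMatrix ℝ))).toFinset

/-- `theta G i` is `θ_i`, where `θ_0 > θ_1 > ⋯` are the distinct eigenvalues of the adjacency
matrix in decreasing order (and `0` beyond the last one). -/
def theta (G : SimpleGraph X) [DecidableRel G.Adj] (i : ℕ) : ℝ :=
  ((eigenvalueSet G).sort (· ≥ ·)).getD i 0

/-- `z̃ = -1 - b_2 b_3 / (z² - b_2)`, for `z² ≠ b_2`. -/
def tilde (G : SimpleGraph X) (z : ℝ) : ℝ :=
  -1 - (b G 2 : ℝ) * (b G 3 : ℝ) / (z ^ 2 - (b G 2 : ℝ))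

/-- The `i`-th distance matrix `A_i`. -/
def distMatrix (G : SimpleGraph X) (i : ℕ) : Matrix X X ℂ :=
  Matrix.of fun y z => if G.dist y z = i then 1 else 0

/-- The `i`-th dual idempotent `E*_i` with respect to the vertex `x`. -/
def Estar (G : SimpleGraph X) (x : X) (i : ℕ) : Matrix X X ℂ :=
  Matrix.diagonal fun y => if G.dist x y = i then 1 else 0

/-- The subconstituent (Terwilliger) algebra `T(x)`, generated by the adjacency matrix and the
dual idempotents (`E*_i = 0` for `i` larger than the diameter). -/
def terwilligerAlgebra (G : SimpleGraph X) [DecidableRel G.Adj] (x : X) :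
    Subalgebra ℂ (Matrix X X ℂ) :=
  Algebra.adjoin ℂ ({G.adjMatrix ℂ} ∪ Set.range (Estar G x))

/-- A subspace of the standard module `ℂ^X` that is closed under the action of `T(x)`. -/
def IsTModule (G : SimpleGraph X) [DecidableRel G.Adj] (x : X)
    (W : Submodule ℂ (EuclideanSpace ℂ X)) : Prop :=
  ∀ B ∈ terwilligerAlgebra G x, ∀ w ∈ W, Matrix.toEuclideanLin B w ∈ W

/-- An irreducible `T(x)`-module. -/
def IsIrreducibleTModule (G : SimpleGraph X) [DecidableRel G.Adj] (x : X)
    (W : Submodule ℂ (EuclideanSpace ℂ X)) : Prop :=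
  IsTModule G x W ∧ W ≠ ⊥ ∧
    ∀ W' : Submodule ℂ (EuclideanSpace ℂ X), IsTModule G x W' → W' ≤ W → W' = ⊥ ∨ W' = W

/-- The subspace `E*_i W`. -/
def subconst (G : SimpleGraph X) (x : X) (i : ℕ) (W : Submodule ℂ (EuclideanSpace ℂ X)) :
    Submodule ℂ (EuclideanSpace ℂ X) :=
  W.map (Matrix.toEuclideanLin (Estar G x i))

/-- `W` is thin: each `E*_i W` has dimension at most `1`. -/
def IsThin (G : SimpleGraph X) (x : X) (W : Submodule ℂ (EuclideanSpace ℂ X)) : Prop :=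
  ∀ i, Module.finrank ℂ (subconst G x i W) ≤ 1

/-- The endpoint of `W`: the least `i` with `E*_i W ≠ 0`. -/
def endpoint (G : SimpleGraph X) (x : X) (W : Submodule ℂ (EuclideanSpace ℂ X)) : ℕ :=
  sInf {i | subconst G x i W ≠ ⊥}

/-- `E*_2 A_2 E*_2` acts on `E*_2 W` as the scalar `η`. For a thin irreducible module `W` of
endpoint `2`, where `E*_2 W` is one-dimensional, this says that `η` is the local eigenvalue
of `W`. -/
def HasLocalEigenvalue (G : SimpleGraph X) (x : X) (W : Submodule ℂ (EuclideanSpace ℂ X))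
    (η : ℝ) : Prop :=
  ∀ w ∈ subconst G x 2 W,
    Matrix.toEuclideanLin (Estar G x 2 * distMatrix G 2 * Estar G x 2) w = (η : ℂ) • w

/-- The vector `E*_{i+2} A_i v`. -/
def basisVec (G : SimpleGraph X) (x : X) (v : EuclideanSpace ℂ X) (i : ℕ) : EuclideanSpace ℂ X :=
  Matrix.toEuclideanLin (Estar G x (i + 2) * distMatrix G i) v

end

end DRG

set_option linter.unusedSectionVars false

namespace DRG

/-! ### Distances, intersection numbers and the recurrence for the distance matrices. -/

section

variable {X : Type*} [Fintype X]

/-! Write V_j = E*_{j+2} A_j v and U_j = E*_{j+2} A_{j+4} v. Endpoint 2 forces the entries of v to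
sum to zero and every A_j v to vanish at distance 1 from x. At distance j+2 from x, parity and the
triangle inequality leave only A_j v, A_{j+2} v, A_{j+4} v, and their sum is zero
(`distSum_add_add`), so each level carries at most the two directions V_j and U_j. Thinness makes
U_j a multiple r_j V_j once V_j ≠ 0.

The matrix A raises V_j to c_{j+1} V_{j+1} and lowers U_{j+1} to b_{j+4} U_j. Hence, if V_{j+1} is
lowered to l_j V_j, then r_{j+1} l_j = b_{j+4} r_j, while l_{j+1} is determined by r_j and r_{j+1}.
The local eigenvalue gives r_0. The recurrence λ p_{i+1} = c_{i+2} p_{i+2} + b_{i+2} p_i solves this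
system in closed form (`ratio`, `lowerScalar`), and `shell_structure` carries the induction. Raising
and lowering are adjoint, so c_{j+1}‖V_{j+1}‖² = l_j‖V_j‖², which gives the norms. Finally l_{D-4}
contains the factor p_{D-1}(θ_n) = 0, so V_{D-3} = 0. The span of V_0, …, V_{D-4} is therefore
T-invariant and equals W by irreducibility.

The argument needs p_i(θ_n) ≠ 0 for i ≤ D-2. The zeros of p_{D-1} are exactly θ_1, …, θ_{D-1}: an
eigenvector for θ ≠ ±k is killed by the all-ones matrix, and there are at least D+1 eigenvalues. So
θ_1 is the largest zero and, for D odd, θ_d is the smallest positive one. A Sturm-type argument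
(`pos_of_pos_of_sign_change`) then fixes the signs of the earlier p_i: at θ_1 directly, at θ_d
through the even-index subsequence started at 0. -/

/-- `G` is a bipartite distance-regular graph of diameter `D ≥ 4` and valency `k`. -/
structure IsBipartiteDRG (G : SimpleGraph X) [DecidableRel G.Adj] (D k : ℕ) : Prop where
  distanceRegular : IsDistanceRegular G
  bipartite : G.IsBipartite
  diam_eq : G.diam = D
  four_le : 4 ≤ D
  regular : G.IsRegularOfDegree k

/-- The sum of `g` over the vertices at distance `j` from `y`, i.e. the `y`-entry of `A_j g`. -/
noncomputable def distSum {R : Type*} [AddCommMonoid R] (G : SimpleGraph X) (g : X → R) (j : ℕ) (y : X) : R :=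
  ∑ z, if G.dist y z = j then g z else 0

lemma interNum_dist {G : SimpleGraph X} (h : IsDistanceRegular G) (i j : ℕ) (y z : X) :
    interNum G (G.dist y z) i j = pairCount G i j y z := by
  have H : ∃ q : X × X, G.dist q.1 q.2 = G.dist y z := ⟨(y, z), rfl⟩
  rw [interNum, dif_pos H]
  exact h.2 _ _ _ _ _ _ H.choose_spec

lemma exists_adj_dist_eq {G : SimpleGraph X} (h : G.Connected) {y z : X} {i : ℕ}
    (hd : G.dist y z = i + 1) : ∃ w, G.Adj y w ∧ G.dist w z = i := by
  obtain ⟨p, hp⟩ := h.exists_walk_length_eq_dist y z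
  cases p with
  | nil => simp at hd
  | @cons _ w _ a q =>
    refine ⟨w, a, ?_⟩
    have h1 := G.dist_le q
    have h2 := h.dist_triangle (u := y) (v := w) (w := z)
    rw [SimpleGraph.dist_eq_one_iff_adj.2 a] at h2
    simp at hp
    omega

namespace IsBipartiteDRG

variable {G : SimpleGraph X} [DecidableRel G.Adj] {D k : ℕ}

lemma connected (h : IsBipartiteDRG G D k) : G.Connected := h.distanceRegular.1

lemma dist_le (h : IsBipartiteDRG G D k) (y z : X) : G.dist y z ≤ D := by
  -- `diam` is 0 by default when the extended diameter is infinite; D ≥ 4 excludes this.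
  have := SimpleGraph.dist_le_diam (G := G) (u := y) (v := z)
    (SimpleGraph.ediam_ne_top_of_diam_ne_zero (by have := h.diam_eq; have := h.four_le; omega))
  rwa [h.diam_eq] at this

lemma exists_dist (h : IsBipartiteDRG G D k) {i : ℕ} (hi : i ≤ D) : ∃ y z, G.dist y z = i := by
  induction hi using Nat.decreasingInduction with
  | self =>
    have := h.connected.nonempty
    obtain ⟨u, v, huv⟩ := G.exists_dist_eq_diam
    exact ⟨u, v, huv.trans h.diam_eq⟩
  | of_succ i _ ih =>
    obtain ⟨y, z, hyz⟩ := ih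
    obtain ⟨w, -, hw⟩ := exists_adj_dist_eq h.connected hyz
    exact ⟨w, z, hw⟩

lemma exists_parity (h : IsBipartiteDRG G D k) :
    ∃ e : X → Bool, ∀ y z, Even (G.dist y z) ↔ (e y ↔ e z) := by
  obtain ⟨col⟩ := h.bipartite
  let col' : G.Coloring Bool := (SimpleGraph.recolorOfEquiv G finTwoEquiv) col
  refine ⟨col', fun y z => ?_⟩
  obtain ⟨p, hp⟩ := h.connected.exists_walk_length_eq_dist y z
  rw [← hp]
  exact col'.even_length_iff_congr p

lemma even_dist_add (h : IsBipartiteDRG G D k) (x y z : X) :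
    Even (G.dist x y + G.dist y z + G.dist x z) := by
  obtain ⟨e, he⟩ := h.exists_parity
  rw [Nat.even_add, Nat.even_add, he, he, he]
  tauto

/-- The triangle inequality allows a change of at most one, and bipartiteness rules out equality of
the two distances. -/
lemma dist_adj (h : IsBipartiteDRG G D k) {y w : X} (a : G.Adj y w) (z : X) :
    G.dist w z = G.dist y z + 1 ∨ G.dist w z + 1 = G.dist y z := by
  have h0 := SimpleGraph.dist_eq_one_iff_adj.2 a
  have h0' := SimpleGraph.dist_eq_one_iff_adj.2 a.symm
  have h1 := h.connected.dist_triangle (u := y) (v := w) (w := z)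
  have h2 := h.connected.dist_triangle (u := w) (v := y) (w := z)
  have h3 := h.even_dist_add y w z
  rw [h0] at h1 h3
  rw [h0'] at h2
  obtain ⟨r, hr⟩ := h3
  omega

lemma pairCount_one (y z : X) (j : ℕ) :
    pairCount G 1 j y z = ((G.neighborFinset y).filter fun w => G.dist w z = j).card := by
  unfold pairCount
  congr 1
  ext w
  simp [SimpleGraph.dist_eq_one_iff_adj]

lemma card_filter_succ (h : IsBipartiteDRG G D k) (y z : X) :
    ((G.neighborFinset y).filter fun w => G.dist w z = G.dist y z + 1).card =
      b G (G.dist y z) := by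
  rw [b, interNum_dist h.distanceRegular, pairCount_one]

lemma card_filter_pred (h : IsBipartiteDRG G D k) (y z : X) :
    ((G.neighborFinset y).filter fun w => G.dist w z + 1 = G.dist y z).card =
      c G (G.dist y z) := by
  rw [c]
  split_ifs with h0
  · simp [h0]
  · rw [interNum_dist h.distanceRegular, pairCount_one]
    congr 1
    ext w
    simp
    intro _
    omega

lemma b_add_c (h : IsBipartiteDRG G D k) {i : ℕ} (hi : i ≤ D) : b G i + c G i = k := by
  classical
  obtain ⟨y, z, rfl⟩ := h.exists_dist hi
  rw [← h.card_filter_succ y z, ← h.card_filter_pred y z, ← Finset.card_union_of_disjoint,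
    ← Finset.filter_or, Finset.filter_true_of_mem, SimpleGraph.card_neighborFinset_eq_degree,
    h.regular y]
  · intro w hw
    exact h.dist_adj ((G.mem_neighborFinset _ _).1 hw) z
  · rw [Finset.disjoint_filter]
    omega

lemma b_diam (h : IsBipartiteDRG G D k) : b G D = 0 := by
  obtain ⟨y, z, hyz⟩ := h.exists_dist le_rfl
  rw [← hyz, ← h.card_filter_succ y z, Finset.card_eq_zero, Finset.filter_eq_empty_iff]
  intro w _ hw
  have := h.dist_le w z
  omega

lemma c_zero : c G 0 = 0 := by simp [c]

lemma b_zero (h : IsBipartiteDRG G D k) : b G 0 = k := by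
  simpa [c_zero] using h.b_add_c (Nat.zero_le _)

lemma c_diam (h : IsBipartiteDRG G D k) : c G D = k := by
  simpa [h.b_diam] using h.b_add_c le_rfl

lemma c_pos (h : IsBipartiteDRG G D k) {i : ℕ} (hi : i + 1 ≤ D) : 0 < c G (i + 1) := by
  obtain ⟨y, z, hyz⟩ := h.exists_dist hi
  rw [← hyz, ← h.card_filter_pred y z, Finset.card_pos]
  obtain ⟨w, a, hw⟩ := exists_adj_dist_eq h.connected hyz
  exact ⟨w, by simp [a, hw, hyz]⟩

lemma b_pos (h : IsBipartiteDRG G D k) {i : ℕ} (hi : i < D) : 0 < b G i := by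
  obtain ⟨z, y, hzy⟩ := h.exists_dist (show i + 1 ≤ D from hi)
  obtain ⟨w, a, hw⟩ := exists_adj_dist_eq h.connected hzy
  rw [← hw, ← h.card_filter_succ w y, Finset.card_pos]
  exact ⟨z, by simp [a.symm, hw, hzy]⟩

lemma c_one (h : IsBipartiteDRG G D k) : c G 1 = 1 := by
  obtain ⟨y, z, hyz⟩ := h.exists_dist (show 1 ≤ D by have := h.four_le; omega)
  rw [← hyz, ← h.card_filter_pred y z, hyz, Finset.card_eq_one]
  refine ⟨z, ?_⟩
  ext w
  simp only [Finset.mem_filter, SimpleGraph.mem_neighborFinset, Finset.mem_singleton,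
    Nat.add_eq_right, h.connected.dist_eq_zero_iff]
  refine ⟨fun hw => hw.2, ?_⟩
  rintro rfl
  exact ⟨SimpleGraph.dist_eq_one_iff_adj.1 hyz, rfl⟩

lemma k_pos (h : IsBipartiteDRG G D k) : 0 < k := by
  rw [← h.b_zero]
  exact h.b_pos (by have := h.four_le; omega)

lemma sum_neighbor_indicator (h : IsBipartiteDRG G D k) (j : ℕ) (y z : X) :
    ((G.neighborFinset y).filter fun w => G.dist w z = j).card =
      (if G.dist y z + 1 = j then b G (j - 1) else 0) +
        (if G.dist y z = j + 1 then c G (j + 1) else 0) := by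
  split_ifs with h1 h2 h2
  · omega
  · rw [← h1, h.card_filter_succ]; simp
  · rw [← h2, ← h.card_filter_pred, h2]; simp
  · rw [add_zero, Finset.card_eq_zero, Finset.filter_eq_empty_iff]
    intro w hw
    have := h.dist_adj ((G.mem_neighborFinset _ _).1 hw) z
    omega

/-- This is A A_j = b_{j-1} A_{j-1} + c_{j+1} A_{j+1}, by exchanging the two sums. The first term is
guarded by `G.dist y z + 1 = j`, so it vanishes at j = 0, where `j - 1` truncates. -/
lemma sum_neighbor_distSum {R : Type*} [CommSemiring R] (h : IsBipartiteDRG G D k)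
    (g : X → R) (j : ℕ) (y : X) :
    ∑ w ∈ G.neighborFinset y, distSum G g j w =
      (∑ z, if G.dist y z + 1 = j then (b G (j - 1) : R) * g z else 0) +
        (c G (j + 1) : R) * distSum G g (j + 1) y := by
  unfold distSum
  rw [Finset.sum_comm, Finset.mul_sum, ← Finset.sum_add_distrib]
  refine Finset.sum_congr rfl fun z _ => ?_
  rw [← Finset.sum_filter, Finset.sum_const, h.sum_neighbor_indicator, nsmul_eq_mul]
  split_ifs <;> simp [add_mul]

lemma sum_neighbor_distSum_zero {R : Type*} [CommSemiring R] (h : IsBipartiteDRG G D k)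
    (g : X → R) (y : X) :
    ∑ w ∈ G.neighborFinset y, distSum G g 0 w = distSum G g 1 y := by
  rw [h.sum_neighbor_distSum, zero_add, h.c_one]
  simp

lemma sum_neighbor_distSum_succ {R : Type*} [CommSemiring R] (h : IsBipartiteDRG G D k)
    (g : X → R) (j : ℕ) (y : X) :
    ∑ w ∈ G.neighborFinset y, distSum G g (j + 1) w =
      (b G j : R) * distSum G g j y + (c G (j + 2) : R) * distSum G g (j + 2) y := by
  rw [h.sum_neighbor_distSum]
  congr 1
  unfold distSum
  rw [Finset.mul_sum]
  refine Finset.sum_congr rfl fun z _ => ?_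
  simp

lemma distSum_zero {R : Type*} [CommSemiring R] (h : IsBipartiteDRG G D k)
    (g : X → R) (y : X) : distSum G g 0 y = g y := by
  classical
  simp [distSum, h.connected.dist_eq_zero_iff]

lemma sum_distSum {R : Type*} [CommSemiring R] (h : IsBipartiteDRG G D k)
    (g : X → R) (y : X) : ∑ j ∈ Finset.range (D + 1), distSum G g j y = ∑ z, g z := by
  unfold distSum
  rw [Finset.sum_comm]
  refine Finset.sum_congr rfl fun z _ => ?_
  rw [Finset.sum_ite_eq, if_pos]
  have := h.dist_le y z
  simp
  omega

lemma distSum_one (h : IsBipartiteDRG G D k) (j : ℕ) (y : X) :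
    distSum G (fun _ => (1 : ℝ)) j y = kval G j := by
  have := interNum_dist h.distanceRegular j j y y
  rw [SimpleGraph.dist_self] at this
  rw [kval, this, pairCount, distSum, Finset.sum_boole]
  congr 2
  ext z
  simp [SimpleGraph.dist_comm (u := z)]

lemma kval_zero (h : IsBipartiteDRG G D k) : kval G 0 = 1 := by
  have := h.connected.nonempty
  obtain ⟨y⟩ := this
  have := h.distSum_one 0 y
  rw [h.distSum_zero] at this
  exact_mod_cast this.symm

/-- Applied to the constant function 1, the distance recurrence reads k k_{i+1} = b_i k_i + c_{i+2}
k_{i+2}. With k = b_{i+1} + c_{i+1} the identity passes from i to i+1. -/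
lemma kval_mul_b (h : IsBipartiteDRG G D k) {i : ℕ} (hi : i + 1 ≤ D) :
    (kval G i : ℝ) * b G i = kval G (i + 1) * c G (i + 1) := by
  have := h.connected.nonempty
  obtain ⟨y⟩ := this
  induction i with
  | zero =>
    have := h.sum_neighbor_distSum_zero (fun _ => (1 : ℝ)) y
    simp only [h.distSum_one, Finset.sum_const, SimpleGraph.card_neighborFinset_eq_degree,
      h.regular y, nsmul_eq_mul] at this
    rw [h.b_zero, zero_add, ← this, h.c_one, mul_comm]
    simp
  | succ i ih =>
    have := h.sum_neighbor_distSum_succ (fun _ => (1 : ℝ)) i y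
    simp only [h.distSum_one, Finset.sum_const, SimpleGraph.card_neighborFinset_eq_degree,
      h.regular y, nsmul_eq_mul] at this
    have h2 : (b G (i + 1) : ℝ) + c G (i + 1) = k := by exact_mod_cast h.b_add_c (by omega)
    rw [← h2] at this
    linarith [ih (by omega)]

end IsBipartiteDRG
end

/-! ### A Sturm-type positivity argument. -/

section

/-- If `g 0 > 0` everywhere, every `g j` is positive at `T`, and `g (j + 2)` is negative at the
zeros of `g (j + 1)` where `g j` is positive, then positivity of `g j` on `(t, T]` forces
positivity of all earlier members of the sequence on `[t, T]`. -/
lemma pos_of_pos_of_sign_change {g : ℕ → ℝ → ℝ} (hcont : ∀ j, Continuous (g j)) {T : ℝ} {N : ℕ}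
    (h0 : ∀ x, 0 < g 0 x) (hT : ∀ j ≤ N, 0 < g j T)
    (hsign : ∀ j, j + 2 ≤ N → ∀ x ≤ T, g (j + 1) x = 0 → 0 < g j x → g (j + 2) x < 0) :
    ∀ j ≤ N, ∀ t < T, (∀ x, t < x → x ≤ T → 0 < g j x) →
      ∀ i < j, ∀ x, t ≤ x → x ≤ T → 0 < g i x := by
  intro j
  induction j with
  | zero => intro _ _ _ _ i hi; omega
  | succ j ih =>
    intro hj t ht hpos
    have key : ∀ x, t ≤ x → x ≤ T → 0 < g j x := by
      rcases Nat.eq_zero_or_pos j with rfl | hj0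
      · exact fun x _ _ => h0 x
      obtain ⟨m, rfl⟩ : ∃ m, j = m + 1 := ⟨j - 1, by omega⟩
      by_contra! hcon
      obtain ⟨x₀, h1, h2, h3⟩ := hcon
      have hcpt : IsCompact (Set.Icc t T ∩ g (m + 1) ⁻¹' Set.Iic 0) :=
        isCompact_Icc.inter_right (isClosed_Iic.preimage (hcont _))
      -- The point s is the rightmost one where `g (m + 1)` is not positive, hence a zero of it. By
      -- induction `g m` is positive at s, so the sign condition makes `g (m + 2)` negative there,
      -- against its positivity just to the right of s.
      obtain ⟨s, ⟨⟨hs1, hs2⟩, hs3⟩, hmax⟩ := hcpt.exists_isMaxOn ⟨x₀, ⟨h1, h2⟩, h3⟩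
        continuousOn_id
      simp only [Set.mem_preimage, Set.mem_Iic] at hs3
      have hgt : ∀ x, s < x → x ≤ T → 0 < g (m + 1) x := by
        intro x hx hxT
        by_contra! hle
        have := hmax (a := x) ⟨⟨by linarith, hxT⟩, hle⟩
        simp only [id, Set.mem_ofPred_eq] at this
        linarith
      have hsT : s < T := by
        rcases hs2.lt_or_eq with h | rfl
        · exact h
        · linarith [hT (m + 1) (by omega)]
      have hs0 : g (m + 1) s = 0 := by
        refine le_antisymm hs3 ?_
        refine ge_of_tendsto (((hcont (m + 1)).tendsto s).mono_left
          (nhdsWithin_le_nhds (s := Set.Ioi s))) ?_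
        filter_upwards [Ioc_mem_nhdsGT hsT] with x hx using (hgt x hx.1 hx.2).le
      have hneg := hsign m hj s hs2 hs0
        (ih (by omega) s hsT hgt m (by omega) s le_rfl hs2)
      have hnn : 0 ≤ g (m + 1 + 1) s := by
        refine ge_of_tendsto (((hcont (m + 1 + 1)).tendsto s).mono_left
          (nhdsWithin_le_nhds (s := Set.Ioi s))) ?_
        filter_upwards [Ioc_mem_nhdsGT hsT] with x hx
        exact (hpos x (by linarith [hx.1]) hx.2).le
      linarith
    intro i hi
    rcases Nat.lt_succ_iff_lt_or_eq.1 hi with hi | rfl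
    · exact ih (by omega) t ht (fun x hx hxT => key x hx.le hxT) i hi
    · exact key

/-- A continuous function that is positive at `T` and has no zero in `(t, T]` is positive there. -/
lemma pos_of_ne_zero_of_pos {f : ℝ → ℝ} (hf : Continuous f) {t T : ℝ} (hT : 0 < f T)
    (hne : ∀ x, t < x → x ≤ T → f x ≠ 0) (x : ℝ) (hx : t < x) (hxT : x ≤ T) : 0 < f x := by
  by_contra! hle
  obtain ⟨y, hy, hy0⟩ := intermediate_value_Icc hxT hf.continuousOn ⟨hle, hT.le⟩
  exact hne y (by linarith [hy.1]) hy.2 hy0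

/-! ### Recurrence, parity and signs of the polynomials p_i. -/

variable {X : Type*} [Fintype X] {G : SimpleGraph X}

lemma pPoly_zero : pPoly G 0 = 1 := by
  simp [pPoly, fPoly]

lemma pPoly_one : pPoly G 1 = fPoly G 1 := by
  simp [pPoly, Finset.sum_filter, Finset.sum_range_succ]

lemma pPoly_add_two (i : ℕ) : pPoly G (i + 2) = pPoly G i + fPoly G (i + 2) := by
  simp only [pPoly, Finset.sum_filter]
  rw [Finset.sum_range_succ, Finset.sum_range_succ]
  simp
  refine Finset.sum_congr rfl fun h hh => ?_
  have hh' : h ≤ i := by simpa [Nat.lt_succ_iff] using hh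
  rw [show i + 2 - h = i - h + 2 by omega]
  simp [Nat.even_add]

lemma sum_fPoly (i : ℕ) :
    ∑ j ∈ Finset.range (i + 2), fPoly G j = pPoly G i + pPoly G (i + 1) := by
  induction i with
  | zero => simp [Finset.sum_range_succ, pPoly_zero, pPoly_one, fPoly]
  | succ i ih => rw [Finset.sum_range_succ, ih, pPoly_add_two]; ring

namespace IsBipartiteDRG
variable [DecidableRel G.Adj] {D k : ℕ}

lemma eval_fPoly_one (h : IsBipartiteDRG G D k) (x : ℝ) : (fPoly G 1).eval x = x := by
  simp [fPoly, h.c_one]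

lemma c_ne_zero (h : IsBipartiteDRG G D k) {i : ℕ} (hi : i + 1 ≤ D) : (c G (i + 1) : ℝ) ≠ 0 := by
  exact_mod_cast (h.c_pos hi).ne'

lemma b_ne_zero (h : IsBipartiteDRG G D k) {i : ℕ} (hi : i < D) : (b G i : ℝ) ≠ 0 := by
  exact_mod_cast (h.b_pos hi).ne'

lemma b_add_c_real (h : IsBipartiteDRG G D k) {i : ℕ} (hi : i ≤ D) :
    (b G i : ℝ) + c G i = k := by exact_mod_cast h.b_add_c hi

lemma eval_fPoly_add_two (h : IsBipartiteDRG G D k) {i : ℕ} (hi : i + 2 ≤ D) (x : ℝ) :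
    x * (fPoly G (i + 1)).eval x =
      b G i * (fPoly G i).eval x + c G (i + 2) * (fPoly G (i + 2)).eval x := by
  rw [fPoly]
  have := h.c_ne_zero hi
  simp only [Polynomial.eval_mul, Polynomial.eval_C, Polynomial.eval_sub, Polynomial.eval_X]
  field_simp
  ring

lemma eval_pPoly_one (h : IsBipartiteDRG G D k) (x : ℝ) : (pPoly G 1).eval x = x := by
  rw [pPoly_one, h.eval_fPoly_one]

/-- The three term recurrence `λ p_{i+1} = c_{i+2} p_{i+2} + b_{i+2} p_i`. -/
lemma eval_pPoly_add_two (h : IsBipartiteDRG G D k) {i : ℕ} (hi : i + 2 ≤ D) (x : ℝ) :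
    x * (pPoly G (i + 1)).eval x =
      c G (i + 2) * (pPoly G (i + 2)).eval x + b G (i + 2) * (pPoly G i).eval x := by
  -- In steps of two, the f-recurrence is added to the p-recurrence two indices lower; the
  -- coefficients match because b_i + c_i = k for every i.
  induction i using Nat.twoStepInduction with
  | zero =>
    have h1 := h.eval_fPoly_add_two hi x
    have h2 := h.b_add_c_real hi
    rw [h.b_zero] at h1
    rw [pPoly_add_two]
    simp only [pPoly_one, pPoly_zero, zero_add, Polynomial.eval_add] at *
    simp only [fPoly, Polynomial.eval_one] at *
    linear_combination h1 - h2
  | one =>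
    have h1 := h.eval_fPoly_add_two hi x
    have h2 := h.b_add_c_real hi
    have h3 := h.eval_fPoly_add_two (i := 0) (by omega) x
    have h4 := h.b_add_c_real (i := 1) (by omega)
    have h5 (j) : (pPoly G (j + 2)).eval x = (pPoly G j).eval x + (fPoly G (j + 2)).eval x := by
      rw [pPoly_add_two, Polynomial.eval_add]
    have h6 := h5 0
    have h7 := h5 1
    simp only [pPoly_zero, h.eval_pPoly_one, h.eval_fPoly_one, h.c_one, Polynomial.eval_one,
      zero_add, Nat.reduceAdd, Nat.cast_one] at *
    linear_combination h1 + x * h4 - x * h2 + x * h6 - c G 3 * h7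
  | more i ih _ =>
    have h1 := h.eval_fPoly_add_two hi x
    have h2 := h.b_add_c_real hi
    have h4 := h.b_add_c_real (i := i + 2) (by omega)
    have ih := ih (by omega)
    have h5 (j) : (pPoly G (j + 2)).eval x = (pPoly G j).eval x + (fPoly G (j + 2)).eval x := by
      rw [pPoly_add_two, Polynomial.eval_add]
    have h6 := h5 i
    have h7 := h5 (i + 1)
    have h8 := h5 (i + 2)
    simp only [add_assoc, Nat.reduceAdd] at *
    linear_combination ih + h1 + x * h7 + (pPoly G (i + 2)).eval x * (h4 - h2) -
      b G (i + 2) * h6 - c G (i + 4) * h8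

lemma eval_neg_pPoly (h : IsBipartiteDRG G D k) {i : ℕ} (hi : i ≤ D) (x : ℝ) :
    (pPoly G i).eval (-x) = (-1) ^ i * (pPoly G i).eval x := by
  induction i using Nat.twoStepInduction with
  | zero => simp [pPoly_zero]
  | one => simp [h.eval_pPoly_one]
  | more i ih1 ih2 =>
    have h1 := h.eval_pPoly_add_two hi x
    have h2 := h.eval_pPoly_add_two hi (-x)
    rw [ih1 (by omega), ih2 (by omega)] at h2
    refine mul_left_cancel₀ (h.c_ne_zero hi) ?_
    rw [pow_succ] at h2
    rw [pow_add]
    linear_combination -h2 + (-1) ^ i * h1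

/-- At λ = k the three-term recurrence telescopes, since k = b_{i+1} + c_{i+1}. This two-term form
gives the positivity of all f_i, and so of all p_i, at k. -/
lemma eval_fPoly_valency (h : IsBipartiteDRG G D k) {i : ℕ} (hi : i + 1 ≤ D) :
    (c G (i + 1) : ℝ) * (fPoly G (i + 1)).eval (k : ℝ) = b G i * (fPoly G i).eval (k : ℝ) := by
  induction i with
  | zero => simp [h.c_one, h.b_zero, fPoly]
  | succ i ih =>
    have h1 := h.eval_fPoly_add_two hi k
    have h2 := h.b_add_c_real (i := i + 1) (by omega)
    linear_combination (fPoly G (i + 1)).eval (k : ℝ) * h2 * (-1) - h1 + ih (by omega)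

lemma eval_fPoly_valency_pos (h : IsBipartiteDRG G D k) {i : ℕ} (hi : i ≤ D) :
    0 < (fPoly G i).eval (k : ℝ) := by
  induction i with
  | zero => simp [fPoly]
  | succ i ih =>
    have h1 := h.eval_fPoly_valency hi
    have h2 : (0 : ℝ) < b G i := by exact_mod_cast h.b_pos hi
    have h3 : (0 : ℝ) < c G (i + 1) := by exact_mod_cast h.c_pos hi
    have h4 := mul_pos h2 (ih (by omega))
    rw [← h1] at h4
    exact pos_of_mul_pos_right h4 h3.le

lemma eval_pPoly_valency_pos (h : IsBipartiteDRG G D k) {i : ℕ} (hi : i ≤ D) :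
    0 < (pPoly G i).eval (k : ℝ) := by
  induction i using Nat.twoStepInduction with
  | zero => simp [pPoly_zero]
  | one => rw [pPoly_one]; exact h.eval_fPoly_valency_pos hi
  | more i ih _ =>
    rw [pPoly_add_two, Polynomial.eval_add]
    exact add_pos (ih (by omega)) (h.eval_fPoly_valency_pos hi)

/-- `(-1)^j p_{2j}(0) > 0`. -/
lemma eval_zero_pPoly_pos (h : IsBipartiteDRG G D k) {j : ℕ} (hj : 2 * j < D) :
    0 < (-1) ^ j * (pPoly G (2 * j)).eval 0 := by
  induction j with
  | zero => simp [pPoly_zero]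
  | succ j ih =>
    have h1 := h.eval_pPoly_add_two (i := 2 * j) (by omega) 0
    have h2 : (0 : ℝ) < b G (2 * j + 2) := by exact_mod_cast h.b_pos (by omega)
    have h3 : (0 : ℝ) < c G (2 * j + 2) := by exact_mod_cast h.c_pos (by omega)
    have h4 := mul_pos h2 (ih (by omega))
    refine pos_of_mul_pos_right (a := (c G (2 * j + 2) : ℝ)) ?_ h3.le
    rw [show 2 * (j + 1) = 2 * j + 2 by ring, pow_succ]
    linear_combination h4 - (-1) ^ j * h1

/-- If `t` is the largest zero of `p_N`, `N < D`, then `p_i (t) > 0` for `i < N`. -/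
lemma eval_pPoly_pos (h : IsBipartiteDRG G D k) {N : ℕ} (hN : N < D) {t : ℝ} (htk : t < k)
    (ht : ∀ x, t < x → (pPoly G N).eval x ≠ 0) {i : ℕ} (hi : i < N) :
    0 < (pPoly G i).eval t := by
  refine pos_of_pos_of_sign_change (g := fun j x => (pPoly G j).eval x) (T := k) (N := N)
    (fun j => (pPoly G j).continuous) (fun x => by simp [pPoly_zero])
    (fun j hj => h.eval_pPoly_valency_pos (by omega)) ?_ N le_rfl t htk
    (pos_of_ne_zero_of_pos (pPoly G N).continuous (h.eval_pPoly_valency_pos hN.le)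
      fun x hx _ => ht x hx) i hi t le_rfl htk.le
  -- At a zero of p_{j+1} the recurrence reads c_{j+2} p_{j+2} = -b_{j+2} p_j.
  intro j hj x _ h1 h2
  have h3 := h.eval_pPoly_add_two (i := j) (by omega) x
  have h4 : (0 : ℝ) < b G (j + 2) := by exact_mod_cast h.b_pos (by omega)
  have h5 : (0 : ℝ) < c G (j + 2) := by exact_mod_cast h.c_pos (by omega)
  rw [h1] at h3
  refine neg_of_mul_neg_right (a := (c G (j + 2) : ℝ)) ?_ h5.le
  linarith [mul_pos h4 h2]

/-- If `t > 0` is at most the smallest positive zero of `p_{2m}`, `2m < D`, then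
`(-1)^j p_{2j}(t) > 0` for `j < m`. -/
lemma eval_pPoly_even_sign (h : IsBipartiteDRG G D k) {m : ℕ} (hm : 2 * m < D) {t : ℝ}
    (ht0 : 0 < t) (ht : ∀ x, 0 < x → x < t → (pPoly G (2 * m)).eval x ≠ 0) {j : ℕ} (hj : j < m) :
    0 < (-1) ^ j * (pPoly G (2 * j)).eval t := by
  have hcont : ∀ j, Continuous fun x : ℝ => (-1) ^ j * (pPoly G (2 * j)).eval x :=
    fun j => continuous_const.mul (pPoly G _).continuous
  have heven : ∀ j ≤ m, ∀ x : ℝ, (pPoly G (2 * j)).eval (-x) = (pPoly G (2 * j)).eval x := by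
    intro j hj x
    rw [h.eval_neg_pPoly (by omega)]
    simp
  have hz : 0 < (-1) ^ m * (pPoly G (2 * m)).eval (0 : ℝ) := h.eval_zero_pPoly_pos hm
  -- The starting point of the Sturm argument is its right endpoint, so it is run on [-t, 0] from
  -- the known signs at 0 and carried to t by evenness.
  have := pos_of_pos_of_sign_change (g := fun j x => (-1) ^ j * (pPoly G (2 * j)).eval x)
    (T := 0) (N := m) hcont (fun x => by simp [pPoly_zero])
    (fun j hj => h.eval_zero_pPoly_pos (by omega)) ?_ m le_rfl (-t) (by linarith)
    (pos_of_ne_zero_of_pos (hcont m) hz ?_) j hj (-t) le_rfl (by linarith)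
  · simpa [heven j hj.le] using this
  · intro j hj x _ h1 h2
    -- At a zero of p_{2j+2}, eliminating the odd-index values from three consecutive recurrences
    -- gives c_{2j+3} c_{2j+4} p_{2j+4} = -b_{2j+2} b_{2j+3} p_{2j}.
    have e1 := h.eval_pPoly_add_two (i := 2 * j) (by omega) x
    have e2 := h.eval_pPoly_add_two (i := 2 * j + 1) (by omega) x
    have e3 := h.eval_pPoly_add_two (i := 2 * j + 2) (by omega) x
    have q1 : (0 : ℝ) < b G (2 * j + 2) := by exact_mod_cast h.b_pos (by omega)
    have q2 : (0 : ℝ) < b G (2 * j + 3) := by exact_mod_cast h.b_pos (by omega)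
    have q3 : (0 : ℝ) < c G (2 * j + 3) := by exact_mod_cast h.c_pos (by omega)
    have q4 : (0 : ℝ) < c G (2 * j + 4) := by exact_mod_cast h.c_pos (by omega)
    simp only [show 2 * (j + 1) = 2 * j + 2 by ring, show 2 * (j + 2) = 2 * j + 4 by ring]
      at h1 h2 ⊢
    have h1' : (pPoly G (2 * j + 2)).eval x = 0 := by simpa using h1
    simp only [add_assoc, Nat.reduceAdd, h1'] at e1 e2 e3
    refine neg_of_mul_neg_right (a := (c G (2 * j + 3) * c G (2 * j + 4) : ℝ)) ?_
      (mul_pos q3 q4).le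
    have := mul_pos (mul_pos q1 q2) h2
    rw [pow_add]
    linear_combination this + (-1) ^ j * (-c G (2 * j + 3) * e3 - x * e2 - b G (2 * j + 3) * e1)
  · intro x hx hx0 he
    have he' : (pPoly G (2 * m)).eval x = 0 := by simpa using he
    rcases hx0.lt_or_eq with hlt | rfl
    · refine ht (-x) (by linarith) (by linarith) ?_
      rw [heven m le_rfl, he']
    · linarith

/-- If `t > 0` is at most the smallest positive zero of `p_{2m}`, `2m < D`, then `p_i(t) ≠ 0`
for `i < 2m`. -/
lemma eval_pPoly_ne_zero (h : IsBipartiteDRG G D k) {m : ℕ} (hm : 2 * m < D) {t : ℝ}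
    (ht0 : 0 < t) (ht : ∀ x, 0 < x → x < t → (pPoly G (2 * m)).eval x ≠ 0) {i : ℕ}
    (hi : i < 2 * m) : (pPoly G i).eval t ≠ 0 := by
  have hev := fun j => h.eval_pPoly_even_sign (j := j) hm ht0 ht
  -- Multiplied by (-1)^{j+1}, the recurrence writes c_{2j+3} p_{2j+3} as t p_{2j+2} minus b_{2j+3}
  -- p_{2j+1} with both contributions positive.
  have hodd : ∀ j < m, 0 < (-1) ^ j * (pPoly G (2 * j + 1)).eval t := by
    intro j
    induction j with
    | zero => intro _; simpa [h.eval_pPoly_one] using ht0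
    | succ j ih =>
      intro hj
      have e := h.eval_pPoly_add_two (i := 2 * j + 1) (by omega) t
      have q2 : (0 : ℝ) < b G (2 * j + 3) := by exact_mod_cast h.b_pos (by omega)
      have q3 : (0 : ℝ) < c G (2 * j + 3) := by exact_mod_cast h.c_pos (by omega)
      have r1 := mul_pos ht0 (hev (j + 1) hj)
      have r2 := mul_pos q2 (ih (by omega))
      simp only [show 2 * (j + 1) = 2 * j + 2 by ring] at r1 ⊢
      simp only [add_assoc, Nat.reduceAdd] at e ⊢
      refine pos_of_mul_pos_right (a := (c G (2 * j + 3) : ℝ)) ?_ q3.le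
      rw [pow_succ] at *
      linear_combination r1 + r2 - (-1) ^ j * e
  rcases Nat.even_or_odd' i with ⟨j, rfl | rfl⟩
  · exact right_ne_zero_of_mul (hev j (by omega)).ne'
  · exact right_ne_zero_of_mul (hodd j (by omega)).ne'

end IsBipartiteDRG
end

/-! ### Eigenvalues of the graph as zeros of p_{D-1}. -/

section

variable {X : Type*} [Fintype X] {G : SimpleGraph X}

lemma natDegree_fPoly_le (i : ℕ) : (fPoly G i).natDegree ≤ i := by
  induction i using Nat.twoStepInduction with
  | zero => simp [fPoly]
  | one =>
    rw [fPoly]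
    exact (Polynomial.natDegree_C_mul_le _ _).trans Polynomial.natDegree_X_le
  | more i ih1 ih2 =>
    rw [fPoly]
    refine (Polynomial.natDegree_C_mul_le _ _).trans
      ((Polynomial.natDegree_sub_le _ _).trans (max_le ?_ ?_))
    · exact Polynomial.natDegree_mul_le.trans
        (by have := Polynomial.natDegree_X_le (R := ℝ); omega)
    · exact (Polynomial.natDegree_C_mul_le _ _).trans (by omega)

lemma natDegree_pPoly_le (i : ℕ) : (pPoly G i).natDegree ≤ i := by
  refine Polynomial.natDegree_sum_le_of_forall_le _ _ fun j hj => ?_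
  have := natDegree_fPoly_le (G := G) j
  simp at hj
  omega

namespace IsBipartiteDRG
variable [DecidableRel G.Adj] {D k : ℕ}

lemma distSum_eigenvector (h : IsBipartiteDRG G D k) {θ : ℝ} {w : X → ℝ}
    (hw : ∀ y, ∑ z ∈ G.neighborFinset y, w z = θ * w y) {j : ℕ} (hj : j ≤ D) (y : X) :
    distSum G w j y = (fPoly G j).eval θ * w y := by
  induction j using Nat.twoStepInduction generalizing y with
  | zero => simp [h.distSum_zero, fPoly]
  | one =>
    rw [← h.sum_neighbor_distSum_zero, h.eval_fPoly_one, ← hw]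
    simp_rw [h.distSum_zero]
  | more j ih1 ih2 =>
    have e1 := h.sum_neighbor_distSum_succ w j y
    have e2 := h.eval_fPoly_add_two hj θ
    rw [Finset.sum_congr rfl fun z _ => ih2 (by omega) z, ← Finset.mul_sum, hw,
      ih1 (by omega)] at e1
    refine mul_left_cancel₀ (h.c_ne_zero hj) ?_
    linear_combination -e1 + w y * e2

lemma abs_le_valency (h : IsBipartiteDRG G D k) {θ : ℝ} {w : X → ℝ} (hw0 : w ≠ 0)
    (hw : ∀ y, ∑ z ∈ G.neighborFinset y, w z = θ * w y) : |θ| ≤ k := by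
  have := h.connected.nonempty
  obtain ⟨y, -, hy⟩ := Finset.exists_max_image Finset.univ (fun y => |w y|) Finset.univ_nonempty
  have hpos : 0 < |w y| := by
    obtain ⟨z, hz⟩ := Function.ne_iff.1 hw0
    exact (abs_pos.2 hz).trans_le (hy z (Finset.mem_univ _))
  refine le_of_mul_le_mul_right ?_ hpos
  rw [← abs_mul, ← hw]
  refine (Finset.abs_sum_le_sum_abs _ _).trans
    ((Finset.sum_le_card_nsmul _ _ _ fun z _ => hy z (Finset.mem_univ _)).trans ?_)
  rw [SimpleGraph.card_neighborFinset_eq_degree, h.regular y, nsmul_eq_mul]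

/-- Eigenvalues other than `±k` are zeros of `p_{D-1}`. -/
lemma eval_pPoly_eigenvalue (h : IsBipartiteDRG G D k) {θ : ℝ} {w : X → ℝ} (hw0 : w ≠ 0)
    (hw : ∀ y, ∑ z ∈ G.neighborFinset y, w z = θ * w y) (h1 : θ ≠ k) (h2 : θ ≠ -k) :
    (pPoly G (D - 1)).eval θ = 0 := by
  obtain ⟨m, rfl⟩ : ∃ m, D = m + 2 := ⟨D - 2, by have := h.four_le; omega⟩
  have hk : (k : ℝ) ≠ 0 := by exact_mod_cast h.k_pos.ne'
  -- The distance matrices sum to the all-ones matrix, and f_0 + ⋯ + f_D = p_{D-1} + p_D. If this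
  -- were nonzero at θ, the eigenvector would be constant and θ = k.
  have hsum : (pPoly G (m + 1)).eval θ + (pPoly G (m + 2)).eval θ = 0 := by
    by_contra hne
    have hconst : ∀ y, ((pPoly G (m + 1)).eval θ + (pPoly G (m + 2)).eval θ) * w y = ∑ z, w z := by
      intro y
      rw [← h.sum_distSum w y, ← Polynomial.eval_add, ← sum_fPoly, Polynomial.eval_finsetSum,
        Finset.sum_mul]
      refine Finset.sum_congr rfl fun j hj => ?_
      rw [h.distSum_eigenvector hw (by simpa [Nat.lt_succ_iff] using hj)]
    obtain ⟨y, hy⟩ := Function.ne_iff.1 hw0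
    have hwy : ∀ z, w z = w y := fun z =>
      mul_left_cancel₀ hne ((hconst z).trans (hconst y).symm)
    have := hw y
    rw [Finset.sum_congr rfl fun z _ => hwy z, Finset.sum_const,
      SimpleGraph.card_neighborFinset_eq_degree, h.regular y, nsmul_eq_mul] at this
    exact h1 (mul_right_cancel₀ hy this).symm
  -- With b_D = 0 and c_D = k the top recurrence reads θ p_{D-1} = k p_D, so (θ + k) p_{D-1}
  -- vanishes at θ.
  have hrec := h.eval_pPoly_add_two le_rfl θ
  rw [h.c_diam, h.b_diam] at hrec
  have : (θ + k) * (pPoly G (m + 1)).eval θ = 0 := by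
    push_cast at hrec
    linear_combination hrec + k * hsum
  rcases mul_eq_zero.1 this with h3 | h3
  · exact absurd (by linarith) h2
  · exact h3

variable [DecidableEq X]

lemma exists_eigenvector {θ : ℝ} (hθ : θ ∈ eigenvalueSet G) :
    ∃ w : X → ℝ, w ≠ 0 ∧ ∀ y, ∑ z ∈ G.neighborFinset y, w z = θ * w y := by
  rw [eigenvalueSet, Set.Finite.mem_toFinset] at hθ
  obtain ⟨w, hw⟩ := Module.End.HasEigenvalue.exists_hasEigenvector hθ
  refine ⟨w, hw.2, fun y => ?_⟩
  have := congrFun hw.apply_eq_smul y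
  simpa [Matrix.toLin'_apply, SimpleGraph.adjMatrix_mulVec_apply] using this

/-- The real symmetric matrix A has an eigenbasis, and each basis vector is killed by one of the
factors. -/
lemma aeval_prod_eigenvalueSet :
    Polynomial.aeval (G.adjMatrix ℝ) (∏ θ ∈ eigenvalueSet G, (Polynomial.X - Polynomial.C θ)) =
      0 := by
  have hA : (G.adjMatrix ℝ).IsHermitian := by
    rw [Matrix.IsHermitian, Matrix.conjTranspose_eq_transpose_of_trivial,
      SimpleGraph.transpose_adjMatrix]
  have key : Polynomial.aeval (Matrix.toLin' (G.adjMatrix ℝ))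
      (∏ θ ∈ eigenvalueSet G, (Polynomial.X - Polynomial.C θ)) = 0 := by
    refine (hA.eigenvectorBasis.toBasis.map (WithLp.linearEquiv 2 ℝ (X → ℝ))).ext fun j => ?_
    have hv : (Matrix.toLin' (G.adjMatrix ℝ)) (⇑(hA.eigenvectorBasis j)) =
        hA.eigenvalues j • ⇑(hA.eigenvectorBasis j) := by
      rw [Matrix.toLin'_apply, hA.mulVec_eigenvectorBasis]
    have hmem : hA.eigenvalues j ∈ eigenvalueSet G := by
      rw [eigenvalueSet, Set.Finite.mem_toFinset]
      refine Module.End.hasEigenvalue_of_hasEigenvector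
        (x := ⇑(hA.eigenvectorBasis j)) ⟨Module.End.mem_eigenspace_iff.2 hv, fun h0 => ?_⟩
      have := hA.eigenvectorBasis.toBasis.ne_zero j
      apply this
      ext y
      simpa using congrFun h0 y
    have : Polynomial.eval (hA.eigenvalues j)
        (∏ θ ∈ eigenvalueSet G, (Polynomial.X - Polynomial.C θ)) = 0 := by
      rw [Polynomial.eval_prod]
      exact Finset.prod_eq_zero hmem (by simp)
    have h2 := Module.End.aeval_apply_of_mem_apply_eq_smul
      (p := ∏ θ ∈ eigenvalueSet G, (Polynomial.X - Polynomial.C θ)) hv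
    rw [this, zero_smul] at h2
    simpa using h2
  rw [← Matrix.toLinAlgEquiv'.injective.eq_iff, map_zero, ← Polynomial.aeval_algHom_apply]
  exact key

/-- Otherwise a monic polynomial of degree e ≤ D annihilates A. Its entry at a pair at distance e
counts the walks of length e, because lower powers of A vanish there; but a geodesic is such a walk.
-/
lemma diam_lt_card_eigenvalueSet (h : IsBipartiteDRG G D k) : D < (eigenvalueSet G).card := by
  by_contra! hle
  obtain ⟨y, z, hyz⟩ := h.exists_dist hle
  have h0 := congrFun (congrFun (aeval_prod_eigenvalueSet (G := G)) y) z
  have hdeg := Polynomial.natDegree_finsetProd_X_sub_C_eq_card (eigenvalueSet G) (fun θ : ℝ => θ)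
  have hmon := Polynomial.monic_prod_X_sub_C (fun θ : ℝ => θ) (eigenvalueSet G)
  rw [Polynomial.aeval_eq_sum_range, hdeg, Finset.sum_range_succ, Matrix.add_apply,
    Matrix.sum_apply, Finset.sum_eq_zero, zero_add] at h0
  · have hc := hmon.coeff_natDegree
    rw [hdeg] at hc
    rw [hc, one_smul, SimpleGraph.adjMatrix_pow_apply_eq_card_walk, Matrix.zero_apply,
      Nat.cast_eq_zero, Fintype.card_eq_zero_iff] at h0
    obtain ⟨p, hp⟩ := h.connected.exists_walk_length_eq_dist y z
    exact h0.false ⟨p, hp.trans hyz⟩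
  · intro i hi
    have : (G.adjMatrix ℝ ^ i) y z = 0 := by
      rw [SimpleGraph.adjMatrix_pow_apply_eq_card_walk, Nat.cast_eq_zero,
        Fintype.card_eq_zero_iff]
      refine ⟨fun p => ?_⟩
      have := G.dist_le p.1
      have h2 : p.1.length = i := p.2
      rw [Finset.mem_range] at hi
      omega
    simp [this]

lemma theta_mem {i : ℕ} (hi : i < (eigenvalueSet G).card) : theta G i ∈ eigenvalueSet G := by
  rw [theta, List.getD_eq_getElem _ _ (by simpa using hi)]
  exact (Finset.mem_sort (· ≥ ·)).1 (List.getElem_mem _)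

lemma theta_lt {i j : ℕ} (hij : i < j) (hj : j < (eigenvalueSet G).card) :
    theta G j < theta G i := by
  rw [theta, theta, List.getD_eq_getElem _ _ (by simpa using hj),
    List.getD_eq_getElem _ _ (by simpa using hij.trans hj)]
  exact (Finset.sortedGT_sort (eigenvalueSet G)).getElem_gt_getElem_of_lt hij

/-- It lies strictly between θ_D ≥ -k and θ_0 ≤ k, so the exact extreme eigenvalues are not needed.
-/
lemma abs_theta_lt (h : IsBipartiteDRG G D k) {i : ℕ} (hi0 : 1 ≤ i) (hi : i < D) :
    |theta G i| < k := by
  have hcard := h.diam_lt_card_eigenvalueSet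
  obtain ⟨w, hw0, hw⟩ := exists_eigenvector (theta_mem (G := G) (i := 0) (by omega))
  obtain ⟨w', hw0', hw'⟩ := exists_eigenvector (theta_mem hcard)
  have h1 := (abs_le.1 (h.abs_le_valency hw0 hw)).2
  have h2 := (abs_le.1 (h.abs_le_valency hw0' hw')).1
  have h3 := theta_lt (G := G) hi0 (by omega)
  have h4 := theta_lt (G := G) hi hcard
  rw [abs_lt]
  constructor <;> linarith

lemma eval_pPoly_theta (h : IsBipartiteDRG G D k) {i : ℕ} (hi0 : 1 ≤ i) (hi : i < D) :
    (pPoly G (D - 1)).eval (theta G i) = 0 := by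
  have hcard := h.diam_lt_card_eigenvalueSet
  obtain ⟨w, hw0, hw⟩ := exists_eigenvector (theta_mem (G := G) (i := i) (by omega))
  have := abs_lt.1 (h.abs_theta_lt hi0 hi)
  exact h.eval_pPoly_eigenvalue hw0 hw this.2.ne this.1.ne'

lemma theta_injOn (h : IsBipartiteDRG G D k) : Set.InjOn (theta G) (Finset.Icc 1 (D - 1)) := by
  have hcard := h.diam_lt_card_eigenvalueSet
  intro i hi j hj hij
  simp only [Finset.coe_Icc, Set.mem_Icc] at hi hj
  rcases lt_trichotomy i j with hlt | rfl | hlt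
  · exact absurd hij (theta_lt hlt (by omega)).ne'
  · rfl
  · exact absurd hij (theta_lt hlt (by omega)).ne

/-- The zeros of `p_{D-1}` are `θ_1, …, θ_{D-1}`. -/
lemma exists_theta_of_eval_eq_zero (h : IsBipartiteDRG G D k) {x : ℝ}
    (hx : (pPoly G (D - 1)).eval x = 0) : ∃ i ∈ Finset.Icc 1 (D - 1), theta G i = x := by
  have hne : pPoly G (D - 1) ≠ 0 := fun h0 => by
    have := h.eval_pPoly_valency_pos (i := D - 1) (by omega)
    simp [h0] at this
  have hsub : (Finset.Icc 1 (D - 1)).image (theta G) ⊆ (pPoly G (D - 1)).roots.toFinset := by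
    intro y hy
    obtain ⟨i, hi, rfl⟩ := Finset.mem_image.1 hy
    rw [Finset.mem_Icc] at hi
    rw [Multiset.mem_toFinset, Polynomial.mem_roots hne]
    exact h.eval_pPoly_theta hi.1 (by omega)
  -- The D-1 distinct known zeros exhaust a nonzero polynomial of degree at most D-1.
  have heq := Finset.eq_of_subset_of_card_le hsub (by
    rw [Finset.card_image_of_injOn h.theta_injOn, Nat.card_Icc, Nat.add_sub_cancel]
    exact (Multiset.toFinset_card_le _).trans
      ((Polynomial.card_roots' _).trans (natDegree_pPoly_le _)))
  have : x ∈ (pPoly G (D - 1)).roots.toFinset := by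
    rw [Multiset.mem_toFinset, Polynomial.mem_roots hne]
    exact hx
  rw [← heq] at this
  simpa only [Finset.mem_image] using this

/-- If `D = 2m + 1`, then `θ_m > 0 > θ_{m+1}`. -/
lemma theta_half (h : IsBipartiteDRG G D k) {m : ℕ} (hm : D = 2 * m + 1) :
    0 < theta G m ∧ theta G (m + 1) < 0 := by
  have hcard := h.diam_lt_card_eigenvalueSet
  have hfour := h.four_le
  set R := (Finset.Icc 1 (D - 1)).image (theta G) with hR
  have hRcard : R.card = 2 * m := by
    rw [hR, Finset.card_image_of_injOn h.theta_injOn, Nat.card_Icc]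
    omega
  have hroot : ∀ y, y ∈ R ↔ (pPoly G (D - 1)).eval y = 0 := by
    intro y
    rw [hR, Finset.mem_image]
    refine ⟨?_, h.exists_theta_of_eval_eq_zero⟩
    rintro ⟨i, hi, rfl⟩
    rw [Finset.mem_Icc] at hi
    exact h.eval_pPoly_theta hi.1 (by omega)
  have hneg : ∀ y ∈ R, -y ∈ R := by
    intro y hy
    rw [hroot] at hy ⊢
    rw [h.eval_neg_pPoly (by omega), hy, mul_zero]
  have h0 : (0 : ℝ) ∉ R := by
    rw [hroot]
    have := h.eval_zero_pPoly_pos (j := m) (by omega)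
    rw [hm, Nat.add_sub_cancel]
    exact right_ne_zero_of_mul this.ne'
  -- The zero set is symmetric and omits 0, so at most m of its 2m elements have a given sign. Were
  -- either claim false, θ_m, …, θ_{2m} would be m+1 negative zeros, or θ_1, …, θ_{m+1} would be m+1
  -- positive ones.
  have hcardeq : (R.filter (· < 0)).card = (R.filter (0 < ·)).card := by
    refine Finset.card_bij' (fun y _ => -y) (fun y _ => -y) ?_ ?_ ?_ ?_
    · intro y hy
      rw [Finset.mem_filter] at hy ⊢
      exact ⟨hneg y hy.1, by linarith [hy.2]⟩
    · intro y hy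
      rw [Finset.mem_filter] at hy ⊢
      exact ⟨hneg y hy.1, by linarith [hy.2]⟩
    · simp
    · simp
  have hdisj : (R.filter (· < 0)).card + (R.filter (0 < ·)).card ≤ 2 * m := by
    rw [← hRcard, ← Finset.card_union_of_disjoint]
    · exact Finset.card_le_card (Finset.union_subset (Finset.filter_subset _ _)
        (Finset.filter_subset _ _))
    · rw [Finset.disjoint_filter]
      intro y _ h1 h2
      linarith
  have himage : ∀ a b : ℕ, 1 ≤ a → b ≤ D - 1 →
      ((Finset.Icc a b).image (theta G)).card = b + 1 - a := by
    intro a b ha hb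
    rw [Finset.card_image_of_injOn, Nat.card_Icc]
    refine h.theta_injOn.mono ?_
    intro i hi
    simp only [Finset.coe_Icc, Set.mem_Icc] at hi ⊢
    omega
  have hmemR : ∀ i, 1 ≤ i → i ≤ D - 1 → theta G i ∈ R := fun i h1 h2 =>
    Finset.mem_image_of_mem _ (Finset.mem_Icc.2 ⟨h1, h2⟩)
  constructor
  · by_contra! hle
    have hlt : theta G m < 0 :=
      lt_of_le_of_ne hle fun he => h0 (he ▸ hmemR m (by omega) (by omega))
    have : (Finset.Icc m (2 * m)).image (theta G) ⊆ R.filter (· < 0) := by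
      intro y hy
      obtain ⟨i, hi, rfl⟩ := Finset.mem_image.1 hy
      rw [Finset.mem_Icc] at hi
      refine Finset.mem_filter.2 ⟨hmemR i (by omega) (by omega), ?_⟩
      rcases hi.1.eq_or_lt with rfl | hmi
      · exact hlt
      · exact (theta_lt hmi (by omega)).trans hlt
    have := Finset.card_le_card this
    rw [himage _ _ (by omega) (by omega)] at this
    omega
  · by_contra! hle
    have hlt : 0 < theta G (m + 1) :=
      lt_of_le_of_ne hle fun he => h0 (he ▸ hmemR (m + 1) (by omega) (by omega))
    have : (Finset.Icc 1 (m + 1)).image (theta G) ⊆ R.filter (0 < ·) := by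
      intro y hy
      obtain ⟨i, hi, rfl⟩ := Finset.mem_image.1 hy
      rw [Finset.mem_Icc] at hi
      refine Finset.mem_filter.2 ⟨hmemR i (by omega) (by omega), ?_⟩
      rcases hi.2.eq_or_lt with rfl | hmi
      · exact hlt
      · exact hlt.trans (theta_lt hmi (by omega))
    have := Finset.card_le_card this
    rw [himage _ _ (by omega) (by omega)] at this
    omega

/-- For `n = 1`, and for `n = ⌊D/2⌋` if `D` is odd, `p_i(θ_n) ≠ 0` for `i ≤ D - 2`. -/
lemma eval_pPoly_theta_ne_zero (h : IsBipartiteDRG G D k) {n : ℕ}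
    (hn : n = 1 ∨ (Odd D ∧ n = D / 2)) {i : ℕ} (hi : i < D - 1) :
    (pPoly G i).eval (theta G n) ≠ 0 := by
  have hcard := h.diam_lt_card_eigenvalueSet
  have hfour := h.four_le
  rcases hn with rfl | ⟨⟨m, hm⟩, rfl⟩
  · refine (h.eval_pPoly_pos (N := D - 1) (by omega)
      (abs_lt.1 (h.abs_theta_lt le_rfl (by omega))).2 ?_ hi).ne'
    intro x hx he
    obtain ⟨j, hj, rfl⟩ := h.exists_theta_of_eval_eq_zero he
    rw [Finset.mem_Icc] at hj
    rcases hj.1.eq_or_lt with rfl | hj1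
    · exact hx.false
    · exact (hx.trans (theta_lt hj1 (by omega))).false
  · have hD2 : D / 2 = m := by omega
    have hD1 : D - 1 = 2 * m := by omega
    obtain ⟨hpos, hneg⟩ := h.theta_half hm
    rw [hD2]
    -- Since θ_{m+1} < 0, no zero of p_{2m} lies strictly between 0 and θ_m.
    refine h.eval_pPoly_ne_zero (m := m) (by omega) hpos ?_ (by omega)
    intro x hx0 hx he
    rw [← hD1] at he
    obtain ⟨j, hj, rfl⟩ := h.exists_theta_of_eval_eq_zero he
    rw [Finset.mem_Icc] at hj
    rcases lt_trichotomy j m with hlt | rfl | hlt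
    · exact (hx.trans (theta_lt hlt (by omega))).false
    · exact hx.false
    · rcases (Nat.succ_le_of_lt hlt).eq_or_lt with rfl | hlt'
      · exact (hx0.trans hneg).false
      · exact (hx0.trans ((theta_lt hlt' (by omega)).trans hneg)).false

end IsBipartiteDRG
end

/-! ### Raising and lowering on the spheres around x. -/

section

variable {X : Type*} [Fintype X] {G : SimpleGraph X}

/-- The function `E*_i A_j g`. -/
noncomputable def shell (G : SimpleGraph X) (x : X) (g : X → ℂ) (i j : ℕ) (y : X) : ℂ :=
  if G.dist x y = i then distSum G g j y else 0

/-- `g` is supported at distance `2` from `x`, sums to zero, and all `A_j g` vanish at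
distance `1` from `x`. -/
structure IsEndpointTwo (G : SimpleGraph X) (x : X) (g : X → ℂ) : Prop where
  support : ∀ y, G.dist x y ≠ 2 → g y = 0
  near : ∀ y j, G.dist x y = 1 → distSum G g j y = 0
  sum_eq_zero : ∑ z, g z = 0

lemma shell_of_eq {x : X} {g : X → ℂ} {i j : ℕ} {y : X} (h : G.dist x y = i) :
    shell G x g i j y = distSum G g j y := if_pos h

lemma shell_of_ne {x : X} {g : X → ℂ} {i j : ℕ} {y : X} (h : G.dist x y ≠ i) :
    shell G x g i j y = 0 := if_neg h

namespace IsBipartiteDRG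
variable [DecidableRel G.Adj] {D k : ℕ} {x : X} {g : X → ℂ}

lemma distSum_eq_zero (h : IsBipartiteDRG G D k) (hg : IsEndpointTwo G x g) {j : ℕ} {y : X}
    (hj : G.dist x y + 2 < j ∨ j + 2 < G.dist x y) : distSum G g j y = 0 := by
  refine Finset.sum_eq_zero fun z _ => ?_
  split_ifs with hz
  · refine hg.support z fun h2 => ?_
    have h3 := h.connected.dist_triangle (u := x) (v := z) (w := y)
    have h4 := h.connected.dist_triangle (u := y) (v := x) (w := z)
    rw [SimpleGraph.dist_comm (u := z)] at h3
    rw [SimpleGraph.dist_comm (u := y) (v := x)] at h4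
    omega
  · rfl

/-- A support vertex of g lies at distance i, i+2 or i+4 from y, by parity and the triangle
inequality, so the three sums together make up the zero total. It serves to eliminate the middle
term A_{i+2} g. -/
lemma distSum_add_add (h : IsBipartiteDRG G D k) (hg : IsEndpointTwo G x g) {i : ℕ} {y : X}
    (hi : G.dist x y = i + 2) :
    distSum G g i y + distSum G g (i + 2) y + distSum G g (i + 4) y = 0 := by
  rw [← hg.sum_eq_zero]
  unfold distSum
  rw [← Finset.sum_add_distrib, ← Finset.sum_add_distrib]
  refine Finset.sum_congr rfl fun z _ => ?_
  by_cases h2 : G.dist x z = 2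
  · have h3 := h.connected.dist_triangle (u := x) (v := z) (w := y)
    have h4 := h.connected.dist_triangle (u := y) (v := x) (w := z)
    have h5 := h.even_dist_add x y z
    rw [SimpleGraph.dist_comm (u := z)] at h3
    rw [SimpleGraph.dist_comm (u := y) (v := x)] at h4
    obtain ⟨r, hr⟩ := h5
    have : G.dist y z = i ∨ G.dist y z = i + 2 ∨ G.dist y z = i + 4 := by omega
    rcases this with h6 | h6 | h6 <;> simp [h6]
  · simp [hg.support z h2]

lemma dist_of_mem_neighborFinset (h : IsBipartiteDRG G D k) {x y w : X}
    (hw : w ∈ G.neighborFinset y) :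
    G.dist x w = G.dist x y + 1 ∨ G.dist x w + 1 = G.dist x y := by
  rw [SimpleGraph.dist_comm (u := x), SimpleGraph.dist_comm (u := x) (v := y)]
  exact h.dist_adj ((G.mem_neighborFinset _ _).1 hw) x

lemma sum_neighbor_shell_eq_zero (h : IsBipartiteDRG G D k) {i j : ℕ} {y : X}
    (h1 : G.dist x y ≠ i + 1) (h2 : G.dist x y + 1 ≠ i) :
    ∑ w ∈ G.neighborFinset y, shell G x g i j w = 0 := by
  refine Finset.sum_eq_zero fun w hw => shell_of_ne ?_
  have := h.dist_of_mem_neighborFinset (x := x) hw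
  omega

/-- The raising part of `A` on `E*_{j+2} A_j g`. -/
lemma sum_neighbor_shell_raise (h : IsBipartiteDRG G D k) (hg : IsEndpointTwo G x g) {j : ℕ}
    {y : X} (hy : G.dist x y = j + 3) :
    ∑ w ∈ G.neighborFinset y, shell G x g (j + 2) j w =
      c G (j + 1) * shell G x g (j + 3) (j + 1) y := by
  -- Neighbours at distance j+4 from x contribute nothing to A_j g, so the restriction to the lower
  -- sphere can be dropped.
  have key : ∀ w ∈ G.neighborFinset y, shell G x g (j + 2) j w = distSum G g j w := by
    intro w hw
    rcases h.dist_of_mem_neighborFinset (x := x) hw with h1 | h1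
    · rw [shell_of_ne (by omega), h.distSum_eq_zero hg (by omega)]
    · rw [shell_of_eq (by omega)]
  rw [Finset.sum_congr rfl key, shell_of_eq hy]
  cases j with
  | zero => rw [h.sum_neighbor_distSum_zero, zero_add, h.c_one, Nat.cast_one, one_mul]
  | succ j =>
    rw [h.sum_neighbor_distSum_succ, h.distSum_eq_zero hg (j := j) (by omega), mul_zero, zero_add]

/-- The lowering part of `A` on `E*_{j+3} A_{j+5} g`. -/
lemma sum_neighbor_shell_lower (h : IsBipartiteDRG G D k) (hg : IsEndpointTwo G x g) {j : ℕ}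
    {y : X} (hy : G.dist x y = j + 2) :
    ∑ w ∈ G.neighborFinset y, shell G x g (j + 3) (j + 5) w =
      b G (j + 4) * shell G x g (j + 2) (j + 4) y := by
  have key : ∀ w ∈ G.neighborFinset y, shell G x g (j + 3) (j + 5) w = distSum G g (j + 5) w := by
    intro w hw
    rcases h.dist_of_mem_neighborFinset (x := x) hw with h1 | h1
    · rw [shell_of_eq (by omega)]
    · rw [shell_of_ne (by omega), h.distSum_eq_zero hg (by omega)]
  rw [Finset.sum_congr rfl key, shell_of_eq hy, h.sum_neighbor_distSum_succ,
    h.distSum_eq_zero hg (j := j + 4 + 2) (by omega), mul_zero, add_zero]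

/-- Since A g vanishes at distance 1, this is A² g = b_0 g + c_2 A_2 g on the second sphere; then
A_2 g = -g - A_4 g and b_0 - c_2 = b_2. -/
lemma sum_neighbor_shell_one (h : IsBipartiteDRG G D k) (hg : IsEndpointTwo G x g) {y : X}
    (hy : G.dist x y = 2) :
    ∑ w ∈ G.neighborFinset y, shell G x g 3 1 w =
      b G 2 * shell G x g 2 0 y - c G 2 * shell G x g 2 4 y := by
  have key : ∀ w ∈ G.neighborFinset y, shell G x g 3 1 w = distSum G g 1 w := by
    intro w hw
    rcases h.dist_of_mem_neighborFinset (x := x) hw with h1 | h1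
    · rw [shell_of_eq (by omega)]
    · rw [shell_of_ne (by omega), hg.near w 1 (by omega)]
  rw [Finset.sum_congr rfl key, h.sum_neighbor_distSum_succ, shell_of_eq hy, shell_of_eq hy]
  have h1 := h.distSum_add_add hg (i := 0) hy
  have h2 : (b G 2 : ℂ) + c G 2 = b G 0 := by
    have h3 := h.b_add_c (i := 2) (by have := h.four_le; omega)
    rw [← h.b_zero] at h3
    exact_mod_cast h3
  linear_combination c G 2 * h1 - distSum G g 0 y * h2

/-- The lowering part of `A` on `E*_{j+4} A_{j+2} g`. -/
lemma sum_neighbor_shell_add_two (h : IsBipartiteDRG G D k) (hg : IsEndpointTwo G x g) {j : ℕ}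
    {y : X} (hy : G.dist x y = j + 3) :
    ∑ w ∈ G.neighborFinset y, shell G x g (j + 4) (j + 2) w =
      (∑ w ∈ G.neighborFinset y, shell G x g (j + 2) (j + 4) w) +
        b G (j + 3) * shell G x g (j + 3) (j + 1) y -
        c G (j + 3) * shell G x g (j + 3) (j + 5) y := by
  -- On the upper sphere A_{j+2} g is the vector wanted, and on the lower one it is minus the sum of
  -- A_j g and A_{j+4} g. Summing over neighbours isolates the lowering part.
  have key : ∀ w ∈ G.neighborFinset y, distSum G g (j + 2) w =
      shell G x g (j + 4) (j + 2) w - shell G x g (j + 2) j w - shell G x g (j + 2) (j + 4) w := by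
    intro w hw
    rcases h.dist_of_mem_neighborFinset (x := x) hw with h1 | h1
    · rw [shell_of_eq (by omega), shell_of_ne (by omega), shell_of_ne (by omega)]
      ring
    · rw [shell_of_ne (by omega), shell_of_eq (by omega), shell_of_eq (by omega)]
      linear_combination h.distSum_add_add hg (i := j) (y := w) (by omega)
  have e := Finset.sum_congr rfl key
  rw [h.sum_neighbor_distSum_succ, Finset.sum_sub_distrib, Finset.sum_sub_distrib,
    h.sum_neighbor_shell_raise hg hy] at e
  rw [shell_of_eq hy] at e
  rw [shell_of_eq hy, shell_of_eq hy]
  have h1 := h.distSum_add_add hg (i := j + 1) hy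
  have h2 : (b G (j + 1) : ℂ) + c G (j + 1) = b G (j + 3) + c G (j + 3) := by
    have hD : j + 3 ≤ D := hy ▸ h.dist_le x y
    exact_mod_cast (h.b_add_c (i := j + 1) (by omega)).trans (h.b_add_c hD).symm
  simp only [add_assoc, Nat.reduceAdd] at e h1 ⊢
  linear_combination c G (j + 3) * h1 - e + distSum G g (j + 1) y * h2

lemma sum_neighbor_shell_two_zero (h : IsBipartiteDRG G D k) (hg : IsEndpointTwo G x g) {y : X}
    (hy : G.dist x y = 1) : ∑ w ∈ G.neighborFinset y, shell G x g 2 0 w = 0 := by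
  rw [← hg.near y 1 hy, ← h.sum_neighbor_distSum_zero]
  refine Finset.sum_congr rfl fun w _ => ?_
  by_cases h2 : G.dist x w = 2
  · rw [shell_of_eq h2]
  · rw [shell_of_ne h2, h.distSum_zero, hg.support w h2]

lemma sum_sum_neighborFinset_comm {R : Type*} [AddCommMonoid R] (F : X → X → R) :
    ∑ y, ∑ z ∈ G.neighborFinset y, F y z = ∑ z, ∑ y ∈ G.neighborFinset z, F y z := by
  refine Finset.sum_comm' fun y z => ?_
  simp [SimpleGraph.adj_comm]

/-- Adjointness of the raising and lowering parts of `A`. -/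
lemma c_mul_sum_norm_sq_shell (h : IsBipartiteDRG G D k) (hg : IsEndpointTwo G x g) {j : ℕ}
    {m : ℝ} (hm : ∀ y, G.dist x y = j + 2 →
      ∑ w ∈ G.neighborFinset y, shell G x g (j + 3) (j + 1) w = m * shell G x g (j + 2) j y) :
    (c G (j + 1) : ℝ) * ∑ y, ‖shell G x g (j + 3) (j + 1) y‖ ^ 2 =
      m * ∑ y, ‖shell G x g (j + 2) j y‖ ^ 2 := by
  -- The inner product of A V_j with V_{j+1}, as a sum over ordered adjacent pairs, is evaluated in
  -- both orders: one meets the raising part, the other the lowering part.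
  have e := sum_sum_neighborFinset_comm (G := G) fun y z =>
    (starRingEnd ℂ) (shell G x g (j + 3) (j + 1) y) * shell G x g (j + 2) j z
  have e1 : ∀ y, ∑ z ∈ G.neighborFinset y,
      (starRingEnd ℂ) (shell G x g (j + 3) (j + 1) y) * shell G x g (j + 2) j z =
      c G (j + 1) * ((‖shell G x g (j + 3) (j + 1) y‖ : ℂ) ^ 2) := by
    intro y
    rw [← Finset.mul_sum]
    by_cases hy : G.dist x y = j + 3
    · rw [h.sum_neighbor_shell_raise hg hy, ← Complex.conj_mul']
      ring
    · simp [shell_of_ne hy]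
  have e2 : ∀ z, ∑ y ∈ G.neighborFinset z,
      (starRingEnd ℂ) (shell G x g (j + 3) (j + 1) y) * shell G x g (j + 2) j z =
      m * ((‖shell G x g (j + 2) j z‖ : ℂ) ^ 2) := by
    intro z
    rw [← Finset.sum_mul, ← map_sum]
    by_cases hz : G.dist x z = j + 2
    · rw [hm z hz, ← Complex.conj_mul', map_mul, Complex.conj_ofReal]
      ring
    · simp [shell_of_ne hz]
  rw [Finset.sum_congr rfl fun y _ => e1 y, Finset.sum_congr rfl fun y _ => e2 y,
    ← Finset.mul_sum, ← Finset.mul_sum] at e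
  exact_mod_cast e

end IsBipartiteDRG
end

/-! ### The scalars of the action and the induction along the spheres. -/

section

variable {X : Type*} [Fintype X] {G : SimpleGraph X}

/-- The scalar by which `E*_{j+2} A_{j+4} v` is a multiple of `E*_{j+2} A_j v`. -/
noncomputable def ratio (G : SimpleGraph X) (θ : ℝ) (j : ℕ) : ℝ :=
  b G (j + 2) * b G (j + 3) * (pPoly G j).eval θ /
    (c G (j + 1) * c G (j + 2) * (pPoly G (j + 2)).eval θ)

/-- The scalar by which the lowering part of `A` sends `E*_{j+3} A_{j+1} v` to `E*_{j+2} A_j v`. -/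
noncomputable def lowerScalar (G : SimpleGraph X) (θ : ℝ) (j : ℕ) : ℝ :=
  b G (j + 2) * c G (j + 3) * (pPoly G (j + 3)).eval θ * (pPoly G j).eval θ /
    (c G (j + 1) * (pPoly G (j + 1)).eval θ * (pPoly G (j + 2)).eval θ)

/-- The square norm of `E*_{j+2} A_j v` for a unit vector `v`. -/
noncomputable def normFactor (G : SimpleGraph X) (k : ℕ) (θ : ℝ) (j : ℕ) : ℝ :=
  ((kval G j : ℝ) * b G j * b G (j + 1) * c G (j + 1) * c G (j + 2)) /
      ((k : ℝ) * b G 1 * (θ ^ 2 - b G 2)) *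
    ((pPoly G (j + 2)).eval θ / (pPoly G j).eval θ)

namespace IsBipartiteDRG
variable [DecidableRel G.Adj] {D k : ℕ} {x : X} {g : X → ℂ} {θ : ℝ}

lemma c_two_mul_eval_pPoly_two (h : IsBipartiteDRG G D k) (θ : ℝ) :
    (c G 2 : ℝ) * (pPoly G 2).eval θ = θ ^ 2 - b G 2 := by
  have := h.eval_pPoly_add_two (i := 0) (by have := h.four_le; omega) θ
  simp only [zero_add, h.eval_pPoly_one, pPoly_zero, Polynomial.eval_one] at this
  linear_combination -this

variable (hp : ∀ i < D - 1, (pPoly G i).eval θ ≠ 0)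
include hp

lemma sq_sub_ne_zero (h : IsBipartiteDRG G D k) : θ ^ 2 - (b G 2 : ℝ) ≠ 0 := by
  have := h.four_le
  rw [← h.c_two_mul_eval_pPoly_two]
  exact mul_ne_zero (h.c_ne_zero (by omega)) (hp 2 (by omega))

lemma denominator_ne_zero (h : IsBipartiteDRG G D k) :
    (k : ℝ) * b G 1 * (θ ^ 2 - b G 2) ≠ 0 := by
  have := h.four_le
  have hk : (k : ℝ) ≠ 0 := by exact_mod_cast h.k_pos.ne'
  exact mul_ne_zero (mul_ne_zero hk (h.b_ne_zero (by omega))) (h.sq_sub_ne_zero hp)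

lemma ratio_zero (h : IsBipartiteDRG G D k) : ratio G θ 0 = -1 - tilde G θ := by
  have h1 := h.sq_sub_ne_zero hp
  have h2 := h.c_two_mul_eval_pPoly_two θ
  simp only [ratio, tilde, zero_add, h.c_one, pPoly_zero, Polynomial.eval_one, Nat.cast_one,
    one_mul, mul_one, h2]
  ring

lemma lowerScalar_zero (h : IsBipartiteDRG G D k) :
    lowerScalar G θ 0 = b G 2 - c G 2 * ratio G θ 0 := by
  have := h.four_le
  have h1 := h.eval_pPoly_add_two (i := 1) (by omega) θ
  have hp1 := hp 1 (by omega)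
  have hp2 := hp 2 (by omega)
  have hc := h.c_ne_zero (i := 1) (by omega)
  simp only [lowerScalar, ratio, zero_add, h.c_one, pPoly_zero, Polynomial.eval_one,
    h.eval_pPoly_one, Nat.cast_one, one_mul, mul_one, Nat.reduceAdd] at *
  field_simp
  linear_combination -(b G 2 : ℝ) * h1

/-- The right side is the coefficient that `sum_neighbor_shell_add_two` produces. The closed form
agrees because eliminating θ p_{j+1} p_{j+3} between the recurrences for θ p_{j+1} and θ p_{j+3}
leaves this identity. -/
lemma lowerScalar_succ (h : IsBipartiteDRG G D k) {j : ℕ} (hj : j + 5 ≤ D) :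
    lowerScalar G θ (j + 1) =
      c G (j + 1) * ratio G θ j + b G (j + 3) - c G (j + 3) * ratio G θ (j + 1) := by
  have h1 := h.eval_pPoly_add_two (i := j) (by omega) θ
  have h2 := h.eval_pPoly_add_two (i := j + 2) (by omega) θ
  have hp2 := hp (j + 2) (by omega)
  have hp3 := hp (j + 3) (by omega)
  have hc1 := h.c_ne_zero (i := j) (by omega)
  have hc2 := h.c_ne_zero (i := j + 1) (by omega)
  have hc3 := h.c_ne_zero (i := j + 2) (by omega)
  simp only [lowerScalar, ratio, add_assoc, Nat.reduceAdd] at *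
  field_simp
  linear_combination b G (j + 3) *
    ((pPoly G (j + 3)).eval θ * h1 - (pPoly G (j + 1)).eval θ * h2)

lemma lowerScalar_ne_zero (h : IsBipartiteDRG G D k) {j : ℕ} (hj : j + 5 ≤ D) :
    lowerScalar G θ j ≠ 0 :=
  div_ne_zero (mul_ne_zero (mul_ne_zero (mul_ne_zero (h.b_ne_zero (by omega))
    (h.c_ne_zero (by omega))) (hp _ (by omega))) (hp _ (by omega)))
    (mul_ne_zero (mul_ne_zero (h.c_ne_zero (by omega)) (hp _ (by omega))) (hp _ (by omega)))

/-- This is the consistency condition obtained by lowering E*_{j+3} A_{j+5} g in two ways; it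
determines the next ratio. -/
lemma ratio_succ (h : IsBipartiteDRG G D k) {j : ℕ} (hj : j + 5 ≤ D) :
    ratio G θ (j + 1) * lowerScalar G θ j = b G (j + 4) * ratio G θ j := by
  have hp1 := hp (j + 1) (by omega)
  have hp2 := hp (j + 2) (by omega)
  have hp3 := hp (j + 3) (by omega)
  have hc1 := h.c_ne_zero (i := j) (by omega)
  have hc2 := h.c_ne_zero (i := j + 1) (by omega)
  have hc3 := h.c_ne_zero (i := j + 2) (by omega)
  simp only [lowerScalar, ratio, add_assoc, Nat.reduceAdd] at *
  field_simp

lemma normFactor_zero (h : IsBipartiteDRG G D k) : normFactor G k θ 0 = 1 := by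
  have := h.four_le
  have h1 := h.sq_sub_ne_zero hp
  have h2 := h.c_two_mul_eval_pPoly_two θ
  have hk : (k : ℝ) ≠ 0 := by exact_mod_cast h.k_pos.ne'
  have hb := h.b_ne_zero (i := 1) (by omega)
  simp only [normFactor, zero_add, h.kval_zero, h.b_zero, h.c_one, pPoly_zero,
    Polynomial.eval_one, Nat.cast_one, one_mul, mul_one, div_one]
  field_simp
  exact h2

lemma c_mul_normFactor_succ (h : IsBipartiteDRG G D k) {j : ℕ} (hj : j + 5 ≤ D) :
    c G (j + 1) * normFactor G k θ (j + 1) = lowerScalar G θ j * normFactor G k θ j := by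
  have h1 := h.denominator_ne_zero hp
  have h2 := h.kval_mul_b (i := j) (by omega)
  have hp0 := hp j (by omega)
  have hp1 := hp (j + 1) (by omega)
  have hp2 := hp (j + 2) (by omega)
  have hc1 := h.c_ne_zero (i := j) (by omega)
  simp only [lowerScalar, normFactor, add_assoc, Nat.reduceAdd] at *
  generalize (k : ℝ) * b G 1 * (θ ^ 2 - b G 2) = K at *
  rw [h2]
  field_simp

omit hp in
lemma lowerScalar_last (h : IsBipartiteDRG G D k) (h0 : (pPoly G (D - 1)).eval θ = 0) :
    lowerScalar G θ (D - 4) = 0 := by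
  have := h.four_le
  rw [lowerScalar, show D - 4 + 3 = D - 1 by omega, h0]
  simp

/-- The action of `A` on the vectors `E*_{j+2} A_j g` and their square norms. -/
lemma shell_structure (h : IsBipartiteDRG G D k) (hg : IsEndpointTwo G x g) (hg0 : g ≠ 0)
    (hbase : ∀ y, shell G x g 2 4 y = ratio G θ 0 * shell G x g 2 0 y)
    (hthin : ∀ j, (∃ y, shell G x g (j + 2) j y ≠ 0) →
      ∃ τ : ℂ, ∀ y, shell G x g (j + 2) (j + 4) y = τ * shell G x g (j + 2) j y)
    {j : ℕ} (hj : j + 4 ≤ D) :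
    (∃ y, shell G x g (j + 2) j y ≠ 0) ∧
    (∀ y, shell G x g (j + 2) (j + 4) y = ratio G θ j * shell G x g (j + 2) j y) ∧
    (∀ y, G.dist x y = j + 2 → ∑ w ∈ G.neighborFinset y, shell G x g (j + 3) (j + 1) w =
      lowerScalar G θ j * shell G x g (j + 2) j y) ∧
    ∑ y, ‖shell G x g (j + 2) j y‖ ^ 2 = normFactor G k θ j * ∑ y, ‖g y‖ ^ 2 := by
  induction j with
  | zero =>
    have hV : ∀ y, shell G x g 2 0 y = g y := by
      intro y
      by_cases hy : G.dist x y = 2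
      · rw [shell_of_eq hy, h.distSum_zero]
      · rw [shell_of_ne hy, hg.support y hy]
    simp only [zero_add]
    refine ⟨?_, hbase, fun y hy => ?_, ?_⟩
    · obtain ⟨y, hy⟩ := Function.ne_iff.1 hg0
      exact ⟨y, by rwa [hV]⟩
    · rw [h.sum_neighbor_shell_one hg hy, hbase, h.lowerScalar_zero hp]
      push_cast
      ring
    · simp [hV, h.normFactor_zero hp]
  | succ j ih =>
    obtain ⟨⟨y₀, hy₀⟩, ihU, ihL, ihN⟩ := ih (by omega)
    have hm0 := h.lowerScalar_ne_zero hp hj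
    have hd₀ : G.dist x y₀ = j + 2 := by
      by_contra hne
      exact hy₀ (shell_of_ne hne)
    -- A nonzero lowering scalar means that V_{j+1} = 0 would force V_j = 0.
    have hne : ∃ y, shell G x g (j + 3) (j + 1) y ≠ 0 := by
      by_contra! hall
      have := ihL y₀ hd₀
      rw [Finset.sum_eq_zero fun w _ => hall w] at this
      exact mul_ne_zero (Complex.ofReal_ne_zero.2 hm0) hy₀ this.symm
    have hU : ∀ y, shell G x g (j + 3) (j + 5) y =
        ratio G θ (j + 1) * shell G x g (j + 3) (j + 1) y := by
      -- Lowering U_{j+1} = τ V_{j+1} at `y₀` gives τ l_j V_j on one side and b_{j+4} r_j V_j on the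
      -- other, so τ is the expected ratio.
      obtain ⟨τ, hτ⟩ := hthin (j + 1) hne
      simp only [add_assoc, Nat.reduceAdd] at hτ
      have e := h.sum_neighbor_shell_lower hg hd₀
      rw [Finset.sum_congr rfl fun w _ => hτ w, ← Finset.mul_sum, ihL y₀ hd₀, ihU,
        ← mul_assoc, ← mul_assoc] at e
      have e2 := mul_right_cancel₀ hy₀ e
      have e3 : (ratio G θ (j + 1) : ℂ) * lowerScalar G θ j = b G (j + 4) * ratio G θ j := by
        exact_mod_cast h.ratio_succ hp hj
      rw [← e3] at e2
      have := mul_right_cancel₀ (Complex.ofReal_ne_zero.2 hm0) e2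
      simpa [this] using hτ
    simp only [add_assoc, Nat.reduceAdd]
    refine ⟨hne, hU, fun y hy => ?_, ?_⟩
    · rw [h.sum_neighbor_shell_add_two hg hy, Finset.sum_congr rfl fun w _ => ihU w,
        ← Finset.mul_sum, h.sum_neighbor_shell_raise hg hy, hU, h.lowerScalar_succ hp hj]
      push_cast
      ring
    · have e := h.c_mul_sum_norm_sq_shell hg ihL
      refine mul_left_cancel₀ (h.c_ne_zero (i := j) (by omega)) ?_
      rw [e, ihN, ← mul_assoc, ← mul_assoc, h.c_mul_normFactor_succ hp hj]

omit hp in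
-- The lowering scalar at D-4 vanishes because p_{D-1}(θ) = 0, so adjointness makes the norm of the
-- next vector zero.
lemma shell_last_eq_zero (h : IsBipartiteDRG G D k) (hg : IsEndpointTwo G x g)
    (h0 : (pPoly G (D - 1)).eval θ = 0)
    (hL : ∀ y, G.dist x y = D - 4 + 2 →
      ∑ w ∈ G.neighborFinset y, shell G x g (D - 4 + 3) (D - 4 + 1) w =
        lowerScalar G θ (D - 4) * shell G x g (D - 4 + 2) (D - 4) y) (y : X) :
    shell G x g (D - 4 + 3) (D - 4 + 1) y = 0 := by
  have e := h.c_mul_sum_norm_sq_shell hg hL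
  rw [h.lowerScalar_last h0, zero_mul] at e
  have := (mul_eq_zero.1 e).resolve_left (h.c_ne_zero (by have := h.four_le; omega))
  rw [Finset.sum_eq_zero_iff_of_nonneg fun _ _ => by positivity] at this
  simpa using this y (Finset.mem_univ y)

end IsBipartiteDRG
end

/-! ### Modules for the subconstituent algebra. -/

section

variable {X : Type*} [Fintype X] [DecidableEq X] {G : SimpleGraph X}

lemma distMatrix_apply (v : EuclideanSpace ℂ X) (j : ℕ) (y : X) :
    Matrix.toEuclideanLin (distMatrix G j) v y = distSum G v.ofLp j y := by
  simp [Matrix.toLpLin_apply, Matrix.mulVec, dotProduct, distMatrix, distSum]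

lemma Estar_apply (x : X) (v : EuclideanSpace ℂ X) (i : ℕ) (y : X) :
    Matrix.toEuclideanLin (Estar G x i) v y = if G.dist x y = i then v y else 0 := by
  simp [Matrix.toLpLin_apply, Estar, Matrix.mulVec_diagonal]

lemma toEuclideanLin_mul_apply (M N : Matrix X X ℂ) (v : EuclideanSpace ℂ X) :
    Matrix.toEuclideanLin (M * N) v = Matrix.toEuclideanLin M (Matrix.toEuclideanLin N v) := by
  simp [Matrix.toLpLin_apply, Matrix.mulVec_mulVec]

lemma Estar_distMatrix_apply (x : X) (v : EuclideanSpace ℂ X) (i j : ℕ) (y : X) :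
    Matrix.toEuclideanLin (Estar G x i * distMatrix G j) v y = shell G x v.ofLp i j y := by
  rw [toEuclideanLin_mul_apply, Estar_apply, distMatrix_apply, shell]

lemma basisVec_apply (x : X) (v : EuclideanSpace ℂ X) (i : ℕ) (y : X) :
    basisVec G x v i y = shell G x v.ofLp (i + 2) i y := Estar_distMatrix_apply x v _ _ y

lemma inner_basisVec_eq_zero (x : X) (v : EuclideanSpace ℂ X) {i j : ℕ} (hij : i ≠ j) :
    inner ℂ (basisVec G x v i) (basisVec G x v j) = 0 := by
  rw [PiLp.inner_apply]
  refine Finset.sum_eq_zero fun y _ => ?_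
  rw [basisVec_apply, basisVec_apply]
  by_cases hy : G.dist x y = i + 2
  · rw [shell_of_ne (i := j + 2) (by omega), inner_zero_right]
  · rw [shell_of_ne (i := i + 2) hy, inner_zero_left]

lemma exists_smul_eq_of_finrank_le_one {K V : Type*} [Field K] [AddCommGroup V] [Module K V]
    [FiniteDimensional K V] {S : Submodule K V} (hS : Module.finrank K S ≤ 1) {a u : V}
    (ha : a ∈ S) (ha0 : a ≠ 0) (hu : u ∈ S) : ∃ τ : K, u = τ • a := by
  obtain ⟨s, hs⟩ := finrank_le_one_iff.1 hS
  obtain ⟨p, hp⟩ := hs ⟨a, ha⟩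
  obtain ⟨q, hq⟩ := hs ⟨u, hu⟩
  have hp' : p • (s : V) = a := congrArg Subtype.val hp
  have hq' : q • (s : V) = u := congrArg Subtype.val hq
  have hp0 : p ≠ 0 := by
    rintro rfl
    exact ha0 (by rw [← hp', zero_smul])
  refine ⟨q * p⁻¹, ?_⟩
  rw [← hp', ← hq', smul_smul, inv_mul_cancel_right₀ hp0]

variable [DecidableRel G.Adj] {x : X} {W : Submodule ℂ (EuclideanSpace ℂ X)}

lemma adjMatrix_apply_euclidean (v : EuclideanSpace ℂ X) (y : X) :
    Matrix.toEuclideanLin (G.adjMatrix ℂ) v y = ∑ w ∈ G.neighborFinset y, v w := by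
  simp [Matrix.toLpLin_apply, SimpleGraph.adjMatrix_mulVec_apply]

lemma IsTModule.adj_mem (hW : IsTModule G x W) {w : EuclideanSpace ℂ X} (hw : w ∈ W) :
    Matrix.toEuclideanLin (G.adjMatrix ℂ) w ∈ W :=
  hW _ (Algebra.subset_adjoin (Or.inl rfl)) w hw

lemma IsTModule.Estar_mem (hW : IsTModule G x W) {w : EuclideanSpace ℂ X} (hw : w ∈ W) (i : ℕ) :
    Matrix.toEuclideanLin (Estar G x i) w ∈ W :=
  hW _ (Algebra.subset_adjoin (Or.inr ⟨i, rfl⟩)) w hw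

lemma IsTModule.subconst_le (hW : IsTModule G x W) (i : ℕ) : subconst G x i W ≤ W := by
  rintro _ ⟨w, hw, rfl⟩
  exact hW.Estar_mem hw i

lemma isTModule_of_mem
    (hA : ∀ w ∈ W, Matrix.toEuclideanLin (G.adjMatrix ℂ) w ∈ W)
    (hE : ∀ i, ∀ w ∈ W, Matrix.toEuclideanLin (Estar G x i) w ∈ W) : IsTModule G x W := by
  intro B hB
  induction hB using Algebra.adjoin_induction with
  | mem B hB =>
    rcases hB with rfl | ⟨i, rfl⟩
    · exact hA
    · exact hE i
  | algebraMap r =>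
    intro w hw
    have : Matrix.toEuclideanLin (algebraMap ℂ (Matrix X X ℂ) r) w = r • w := by
      simp [Algebra.algebraMap_eq_smul_one]
    rw [this]
    exact W.smul_mem r hw
  | add B C _ _ hB hC =>
    intro w hw
    rw [map_add, LinearMap.add_apply]
    exact W.add_mem (hB w hw) (hC w hw)
  | mul B C _ _ hB hC =>
    intro w hw
    rw [toEuclideanLin_mul_apply]
    exact hB _ (hC w hw)

namespace IsBipartiteDRG
variable {D k : ℕ} {v : EuclideanSpace ℂ X} {θ : ℝ}

/-- Up to D the recurrence expresses A_j through the generator A; beyond D, A_j is zero. -/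
lemma distMatrix_mem (h : IsBipartiteDRG G D k) (hW : IsTModule G x W) (hv : v ∈ W) (j : ℕ) :
    Matrix.toEuclideanLin (distMatrix G j) v ∈ W := by
  induction j using Nat.twoStepInduction with
  | zero =>
    convert hv using 1
    ext y
    rw [distMatrix_apply, h.distSum_zero]
  | one =>
    convert hW.adj_mem hv using 1
    ext y
    rw [distMatrix_apply, adjMatrix_apply_euclidean, ← h.sum_neighbor_distSum_zero]
    simp_rw [h.distSum_zero]
  | more j ih1 ih2 =>
    by_cases hj : j + 2 ≤ D
    · have hc : (c G (j + 2) : ℂ) ≠ 0 := by exact_mod_cast (h.c_pos hj).ne'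
      have : Matrix.toEuclideanLin (distMatrix G (j + 2)) v = (c G (j + 2) : ℂ)⁻¹ •
          (Matrix.toEuclideanLin (G.adjMatrix ℂ) (Matrix.toEuclideanLin (distMatrix G (j + 1)) v) -
            (b G j : ℂ) • Matrix.toEuclideanLin (distMatrix G j) v) := by
        ext y
        simp only [PiLp.smul_apply, PiLp.sub_apply, distMatrix_apply, adjMatrix_apply_euclidean,
          smul_eq_mul]
        rw [h.sum_neighbor_distSum_succ]
        field_simp
        ring
      rw [this]
      exact W.smul_mem _ (W.sub_mem (hW.adj_mem ih2) (W.smul_mem _ ih1))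
    · convert W.zero_mem using 1
      ext y
      rw [distMatrix_apply]
      refine Finset.sum_eq_zero fun z _ => if_neg ?_
      have := h.dist_le y z
      omega

lemma shell_mem_subconst (h : IsBipartiteDRG G D k) (hW : IsTModule G x W) (hv : v ∈ W)
    (i j : ℕ) : Matrix.toEuclideanLin (Estar G x i * distMatrix G j) v ∈ subconst G x i W := by
  rw [toEuclideanLin_mul_apply]
  exact Submodule.mem_map_of_mem (h.distMatrix_mem hW hv j)

lemma isEndpointTwo (h : IsBipartiteDRG G D k) (hW : IsTModule G x W)
    (hend : endpoint G x W = 2) (hvW : v ∈ subconst G x 2 W) : IsEndpointTwo G x v.ofLp := by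
  have hv := hW.subconst_le 2 hvW
  have hsupp : ∀ y, G.dist x y ≠ 2 → v.ofLp y = 0 := by
    obtain ⟨w, -, rfl⟩ := hvW
    intro y hy
    rw [Estar_apply, if_neg hy]
  have hbot : ∀ i < 2, subconst G x i W = ⊥ := by
    intro i hi
    rw [← hend] at hi
    simpa using Nat.notMem_of_lt_sInf hi
  have hzero : ∀ i < 2, ∀ j y, G.dist x y = i → distSum G v.ofLp j y = 0 := by
    intro i hi j y hy
    have h1 := h.shell_mem_subconst hW hv i j
    rw [hbot i hi, Submodule.mem_bot] at h1
    rw [← shell_of_eq hy, ← Estar_distMatrix_apply, h1]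
    simp
  refine ⟨hsupp, fun y j => hzero 1 (by norm_num) j y, ?_⟩
  -- The entry of A_2 v at x itself is the sum of v over its whole support.
  rw [← hzero 0 (by norm_num) 2 x SimpleGraph.dist_self]
  refine Finset.sum_congr rfl fun z _ => ?_
  split_ifs with hz
  · rfl
  · exact hsupp z hz

/-- On the second sphere A_2 v = η v and v + A_2 v + A_4 v = 0, so A_4 v = (-1 - η) v there, which
is the first ratio. -/
lemma shell_two_four (h : IsBipartiteDRG G D k) (hp : ∀ i < D - 1, (pPoly G i).eval θ ≠ 0)
    (hg : IsEndpointTwo G x v.ofLp) (hvW : v ∈ subconst G x 2 W)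
    (hloc : HasLocalEigenvalue G x W (tilde G θ)) (y : X) :
    shell G x v.ofLp 2 4 y = ratio G θ 0 * shell G x v.ofLp 2 0 y := by
  by_cases hy : G.dist x y = 2
  · have hEv : Matrix.toEuclideanLin (Estar G x 2) v = v := by
      ext z
      rw [Estar_apply]
      split_ifs with hz
      · rfl
      · exact (hg.support z hz).symm
    have h1 := congrArg (fun u => u.ofLp y) (hloc v hvW)
    simp only [PiLp.smul_apply, smul_eq_mul] at h1
    rw [toEuclideanLin_mul_apply, hEv, Estar_distMatrix_apply, shell_of_eq hy] at h1
    have h2 := h.distSum_add_add hg (i := 0) hy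
    simp only [zero_add, h1, h.distSum_zero] at h2
    rw [shell_of_eq hy, shell_of_eq hy, h.ratio_zero hp, h.distSum_zero]
    push_cast
    linear_combination h2
  · rw [shell_of_ne hy, shell_of_ne hy, mul_zero]

lemma adj_basisVec_zero (h : IsBipartiteDRG G D k) (hg : IsEndpointTwo G x v.ofLp) :
    Matrix.toEuclideanLin (G.adjMatrix ℂ) (basisVec G x v 0) = basisVec G x v 1 := by
  ext y
  simp only [adjMatrix_apply_euclidean, basisVec_apply, zero_add, Nat.reduceAdd]
  by_cases h3 : G.dist x y = 3
  · rw [h.sum_neighbor_shell_raise hg (j := 0) h3, zero_add, h.c_one]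
    simp
  · rw [shell_of_ne h3]
    by_cases h1 : G.dist x y = 1
    · exact h.sum_neighbor_shell_two_zero hg h1
    · exact h.sum_neighbor_shell_eq_zero (by omega) (by omega)

lemma adj_basisVec_succ (h : IsBipartiteDRG G D k) (hg : IsEndpointTwo G x v.ofLp) {j : ℕ}
    {m : ℂ} (hm : ∀ y, G.dist x y = j + 2 →
      ∑ w ∈ G.neighborFinset y, shell G x v.ofLp (j + 3) (j + 1) w =
        m * shell G x v.ofLp (j + 2) j y) :
    Matrix.toEuclideanLin (G.adjMatrix ℂ) (basisVec G x v (j + 1)) =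
      (c G (j + 2) : ℂ) • basisVec G x v (j + 2) + m • basisVec G x v j := by
  ext y
  simp only [adjMatrix_apply_euclidean, basisVec_apply, PiLp.add_apply, PiLp.smul_apply,
    smul_eq_mul, add_assoc, Nat.reduceAdd]
  by_cases h4 : G.dist x y = j + 4
  · rw [h.sum_neighbor_shell_raise hg (j := j + 1) h4, shell_of_ne (i := j + 2) (by omega)]
    simp only [add_assoc, Nat.reduceAdd, mul_zero, add_zero]
  · rw [shell_of_ne h4, mul_zero, zero_add]
    by_cases h2 : G.dist x y = j + 2
    · exact hm y h2
    · rw [shell_of_ne h2, mul_zero]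
      exact h.sum_neighbor_shell_eq_zero (by omega) (by omega)

end IsBipartiteDRG

lemma Estar_basisVec (x : X) (v : EuclideanSpace ℂ X) (i j : ℕ) :
    Matrix.toEuclideanLin (Estar G x i) (basisVec G x v j) =
      if j + 2 = i then basisVec G x v j else 0 := by
  ext y
  rw [Estar_apply, basisVec_apply]
  split_ifs with h1 h2 h2
  · rw [basisVec_apply]
  · rw [shell_of_ne (by omega)]
    simp
  · rw [basisVec_apply, shell_of_ne (by omega)]
  · simp

end

end DRG

/-! ### Assembly of the theorem. -/

theorem mainTheorem8 {X : Type*} [Fintype X] [DecidableEq X]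
    (G : SimpleGraph X) [DecidableRel G.Adj]
    (hdr : DRG.IsDistanceRegular G) (hbip : G.IsBipartite)
    (D : ℕ) (hdiam : G.diam = D) (hD : 4 ≤ D)
    (k : ℕ) (hreg : G.IsRegularOfDegree k) (hk : 3 ≤ k)
    (x : X) (n : ℕ) (hn : n = 1 ∨ (Odd D ∧ n = D / 2))
    (W : Submodule ℂ (EuclideanSpace ℂ X))
    (hirr : DRG.IsIrreducibleTModule G x W) (hthin : DRG.IsThin G x W)
    (hend : DRG.endpoint G x W = 2)
    (hloc : DRG.HasLocalEigenvalue G x W (DRG.tilde G (DRG.theta G n)))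
    (v : EuclideanSpace ℂ X) (hvW : v ∈ DRG.subconst G x 2 W) (hv : v ≠ 0) :
    -- the vectors `E*_{i+2} A_i v`, `0 ≤ i ≤ D - 4`, form a basis of `W`
    (LinearIndependent ℂ (fun i : Fin (D - 3) => DRG.basisVec G x v i) ∧
      Submodule.span ℂ (Set.range fun i : Fin (D - 3) => DRG.basisVec G x v i) = W) ∧
    -- they are mutually orthogonal
    (∀ i j : ℕ, i ≤ D - 4 → j ≤ D - 4 → i ≠ j →
      inner ℂ (DRG.basisVec G x v i) (DRG.basisVec G x v j) = 0) ∧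
    -- the denominators do not vanish, and the square norms are as claimed
    (k : ℝ) * DRG.b G 1 * (DRG.theta G n ^ 2 - DRG.b G 2) ≠ 0 ∧
    (∀ i : ℕ, i ≤ D - 4 →
      (DRG.pPoly G i).eval (DRG.theta G n) ≠ 0 ∧
      ‖DRG.basisVec G x v i‖ ^ 2 =
        ((DRG.kval G i : ℝ) * DRG.b G i * DRG.b G (i + 1) * DRG.c G (i + 1) * DRG.c G (i + 2)) /
            ((k : ℝ) * DRG.b G 1 * (DRG.theta G n ^ 2 - DRG.b G 2)) *
          ((DRG.pPoly G (i + 2)).eval (DRG.theta G n) / (DRG.pPoly G i).eval (DRG.theta G n)) *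
          ‖v‖ ^ 2) := by
  have h : DRG.IsBipartiteDRG G D k := ⟨hdr, hbip, hdiam, hD, hreg⟩
  obtain ⟨hT, -, hmin⟩ := hirr
  have hp : ∀ i < D - 1, (DRG.pPoly G i).eval (DRG.theta G n) ≠ 0 :=
    fun i hi => h.eval_pPoly_theta_ne_zero hn hi
  have hroot : (DRG.pPoly G (D - 1)).eval (DRG.theta G n) = 0 := by
    refine h.eval_pPoly_theta ?_ ?_ <;> rcases hn with rfl | ⟨-, rfl⟩ <;> omega
  have hg := h.isEndpointTwo hT hend hvW
  have hvmem := hT.subconst_le 2 hvW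
  have hg0 : v.ofLp ≠ 0 := fun h0 => hv (by ext y; exact congrFun h0 y)
  have hcollinear : ∀ j, (∃ y, DRG.shell G x v.ofLp (j + 2) j y ≠ 0) →
      ∃ τ : ℂ, ∀ y, DRG.shell G x v.ofLp (j + 2) (j + 4) y =
        τ * DRG.shell G x v.ofLp (j + 2) j y := by
    rintro j ⟨y, hy⟩
    obtain ⟨τ, hτ⟩ := DRG.exists_smul_eq_of_finrank_le_one (hthin (j + 2))
      (h.shell_mem_subconst hT hvmem (j + 2) j)
      (fun h0 => hy (by rw [← DRG.Estar_distMatrix_apply, h0]; simp))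
      (h.shell_mem_subconst hT hvmem (j + 2) (j + 4))
    refine ⟨τ, fun z => ?_⟩
    have := congrArg (fun u => u.ofLp z) hτ
    simpa only [PiLp.smul_apply, smul_eq_mul, DRG.Estar_distMatrix_apply] using this
  have key := fun j (hj : j + 4 ≤ D) => h.shell_structure hp hg hg0
    (h.shell_two_four hp hg hvW hloc) hcollinear hj
  have hne : ∀ j, j + 4 ≤ D → DRG.basisVec G x v j ≠ 0 := by
    intro j hj h0
    obtain ⟨y, hy⟩ := (key j hj).1
    exact hy (by rw [← DRG.basisVec_apply, h0]; simp)
  have hlast : DRG.basisVec G x v (D - 4 + 1) = 0 := by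
    ext y
    rw [DRG.basisVec_apply]
    exact h.shell_last_eq_zero hg hroot (key (D - 4) (by omega)).2.2.1 y
  refine ⟨⟨?_, ?_⟩, fun i j _ _ hij => DRG.inner_basisVec_eq_zero x v hij,
    h.denominator_ne_zero hp, fun i hi => ⟨hp i (by omega), ?_⟩⟩
  · exact linearIndependent_of_ne_zero_of_inner_eq_zero (fun i => hne i (by omega))
      fun i j hij => DRG.inner_basisVec_eq_zero x v (Fin.val_injective.ne hij)
  · set S := Submodule.span ℂ (Set.range fun i : Fin (D - 3) => DRG.basisVec G x v i) with hS
    -- The range goes one index past the spanning family: raising the last vector lands at index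
    -- D-3, where the vector is zero. This is what closes the span under A.
    have hmem : ∀ j, j + 3 ≤ D → DRG.basisVec G x v j ∈ S := by
      intro j hj
      rcases hj.lt_or_eq with hlt | heq
      · exact Submodule.subset_span ⟨⟨j, by omega⟩, rfl⟩
      · rw [show j = D - 4 + 1 by omega, hlast]
        exact S.zero_mem
    have hST : DRG.IsTModule G x S := by
      refine DRG.isTModule_of_mem (fun w hw => ?_) fun i w hw => ?_
      · refine Submodule.span_le (p := S.comap (Matrix.toEuclideanLin (G.adjMatrix ℂ))).2 ?_ hw
        rintro _ ⟨⟨j, hj⟩, rfl⟩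
        simp only [SetLike.mem_coe, Submodule.mem_comap]
        cases j with
        | zero =>
          rw [h.adj_basisVec_zero hg]
          exact hmem 1 (by omega)
        | succ j =>
          rw [h.adj_basisVec_succ hg (key j (by omega)).2.2.1]
          exact S.add_mem (S.smul_mem _ (hmem _ (by omega))) (S.smul_mem _ (hmem _ (by omega)))
      · refine Submodule.span_le (p := S.comap (Matrix.toEuclideanLin (DRG.Estar G x i))).2 ?_ hw
        rintro _ ⟨⟨j, hj⟩, rfl⟩
        simp only [SetLike.mem_coe, Submodule.mem_comap]
        rw [DRG.Estar_basisVec]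
        split_ifs
        · exact hmem j (by omega)
        · exact S.zero_mem
    have hSW : S ≤ W := by
      refine Submodule.span_le.2 ?_
      rintro _ ⟨j, rfl⟩
      exact hT.subconst_le _ (h.shell_mem_subconst hT hvmem _ _)
    refine (hmin S hST hSW).resolve_left fun hbot => hne 0 (by omega) ?_
    have := hmem 0 (by omega)
    rwa [hbot, Submodule.mem_bot] at this
  · have := (key i (by omega)).2.2.2
    rw [EuclideanSpace.norm_sq_eq, EuclideanSpace.norm_sq_eq]
    simp_rw [DRG.basisVec_apply]
    exact this
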